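/- Fix $p\in\mathbb N$ and $k>0$. Let $\mathrm{Sym}^+(p)$ be the set of real symmetric positive-definite $p\times p$ matrices, $\mathrm{Diag}^+(p)$ the set of diagonal matrices with positive diagonal entries, $M(p)=SO(p)\times \mathrm{Diag}^+(p)$, and $F:M(p)\to \mathrm{Sym}^+(p)$, $F(U,D)=UDU^T$, with fibers $\mathcal E_X=F^{-1}(X)$. Give $SO(p)$ the bi-invariant Riemannian metric equal to $-\tfrac12\mathrm{tr}(A_1A_2)$ at the identity, $\mathrm{Diag}^+(p)$ the metric $\mathrm{tr}(D^{-1}L_1D^{-1}L_2)$, and $M(p)$ the product metric $k\,g_{SO}\oplus g_{\mathrm{Diag}^+}$, with geodesic distance $d_M$. Let $d_{SR}(X,Y)=\inf\{d_M(q,r):q\in\mathcal E_X,\ r\in\mathcal E_Y\}$. An $F$-minimal geodesic from $\mathcal E_X$ to $\mathcal E_Y$ is a geodesic $\gamma:[0,1]\to M(p)$ with $\gamma(0)\in\mathcal E_X$, $\gamma(1)\in\mathcal E_Y$ and length $d_{SR}(X,Y)$; then $\chi=F\circ\gamma:[0,1]\to \mathrm{Sym}^+(p)$ is called a minimal smooth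 scaling-rotation (MSSR) curve from $X$ to $Y$ corresponding to the minimal pair $(\gamma(0),\gamma(1))$. A pair $(U,V)$ in $SO(p)\times SO(p)$ is geodesically antipodal if one of $U,V$ lies in the cut locus of the other in the Riemannian manifold $SO(p)$. For diagonal $D,\Lambda$ let $G_D=\{R\in SO(p):RDR^T=D\}$ and $G_{D,\Lambda}=G_D\cap G_\Lambda$, with identity components $G_D^0$ and $G_{D,\Lambda}^0$. Let $\tilde S_p^+$ be the group of even signed permutations; its element $g$ has a matrix $P_g\in SO(p)$ (a signed-permutation matrix of determinant $1$) and an underlying permutation $\pi_g\in S_p$, and $\pi\cdot D$ denotes the natural action of $S_p$ on diagonal matrices, so that $P_gDP_g^{-1}=\pi_g\cdot D$. **Proposition.** Let $X\ne Y$ in $\mathrm{Sym}^+(p)$, $(U,D)\in\mathcal E_X$, $(V,\Lambda)\in\mathcal E_Y$. For $i=1,2$ let $R_{U,i}\in G_D^0$, $R_{V,i}\in G_\Lambda^0$, $g_i\in\tilde S_p^+$, $\Lambda_i=\pi_{g_i}\cdot\Lambda$, and let $\chi_i=F\circ\gamma_i$ be an MSSR curve from $X$ to $Y$ corresponding to the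 minimal pair $((UR_{U,i},D),(VR_{V,i}P_{g_i}^{-1},\Lambda_i))$, where $\gamma_i:[0,1]\to M(p)$ is an $F$-minimal geodesic joining the two points of this pair. (The two minimal pairs need not be distinct.) Then $\chi_1=\chi_2$ if and only if both of the following hold. (i) Either both pairs $(UR_{U,i},VR_{V,i}P_{g_i}^{-1})$ are geodesically non-antipodal and $$R_{V,2}P_{g_2}^{-1}R_{U,2}^{-1}=R_{V,1}P_{g_1}^{-1}R_{U,1}^{-1},\tag{a}$$ or both pairs are geodesically antipodal and $$(\mathrm{proj}_{SO(p)}\gamma_1'(0))R_{U,1}^{-1}=(\mathrm{proj}_{SO(p)}\gamma_2'(0))R_{U,2}^{-1},\tag{b}$$ where $\mathrm{proj}_{SO(p)}$ is the projection $T_{(U',D')}M(p)\to T_{U'}SO(p)$. (ii) There exist $g\in\tilde S_p^+$ and $R\in G^0_{D,\Lambda_1}$ such that $D=\pi_g\cdot D$, $\Lambda_2=\pi_g\cdot\Lambda_1$ and $R_{U,1}^{-1}R_{U,2}=RP_g^{-1}$. Moreover (b) implies (a), so (a) is always necessary for $\chi_1=\chi_2$. -/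

import Mathlib

open Set
open scoped ContDiff Matrix

attribute [local instance] Matrix.frobeniusNormedAddCommGroup Matrix.frobeniusNormedSpace

namespace ScalingRotation

/-- Real `p × p` matrices; `‖·‖` is the Frobenius norm. -/
abbrev Mat (p : ℕ) := Matrix (Fin p) (Fin p) ℝ

section Riemannian

variable {E : Type*} [NormedAddCommGroup E] [NormedSpace ℝ E]

/-! Riemannian notions for a submanifold `S` of a vector space `E`.  The metric is a function
`g x v w`, used only for `x ∈ S` and `v`, `w` tangent to `S` at `x`. -/

/-- The Riemannian length of the part of `γ` over `[a, b]`. -/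
noncomputable def curveLength (g : E → E → E → ℝ) (γ : ℝ → E) (a b : ℝ) : ℝ :=
  ∫ t in a..b, Real.sqrt (g (γ t) (deriv γ t) (deriv γ t))

/-- `γ` is, on `[0, 1]`, a piecewise smooth curve in `S`: smooth on each closed interval of a
subdivision `0 = t₀ < t₁ < ⋯ < tₙ = 1` (hence continuous on `[0, 1]`). -/
def IsPiecewiseSmoothIn (S : Set E) (γ : ℝ → E) : Prop :=
  MapsTo γ (Icc 0 1) S ∧
    ∃ (n : ℕ) (t : Fin (n + 1) → ℝ), StrictMono t ∧ t 0 = 0 ∧ t (Fin.last n) = 1 ∧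
      ∀ i : Fin n, ContDiffOn ℝ ∞ γ (Icc (t i.castSucc) (t i.succ))

/-- The geodesic distance: the infimum of the lengths of the piecewise smooth curves in `S`
from `x` to `y`. -/
noncomputable def geodesicDist (S : Set E) (g : E → E → E → ℝ) (x y : E) : ℝ :=
  sInf {ℓ | ∃ γ : ℝ → E, IsPiecewiseSmoothIn S γ ∧ γ 0 = x ∧ γ 1 = y ∧ curveLength g γ 0 1 = ℓ}

/-- `γ` is a Riemannian geodesic of `(S, g)` on the interval `I`: a smooth curve in `S` of constant
speed that is locally length minimizing. -/
structure IsGeodesicOn (S : Set E) (g : E → E → E → ℝ) (γ : ℝ → E) (I : Set ℝ) : Prop where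
  mapsTo : MapsTo γ I S
  smooth : ContDiffOn ℝ ∞ γ I
  constSpeed : ∃ c : ℝ, ∀ t ∈ I, Real.sqrt (g (γ t) (derivWithin γ I t) (derivWithin γ I t)) = c
  locallyMinimizing : ∀ t ∈ I, ∃ ε > 0, ∀ a ∈ I, ∀ b ∈ I, |a - t| < ε → |b - t| < ε → a ≤ b →
    curveLength g γ a b = geodesicDist S g (γ a) (γ b)

/-- The cut locus of `x` in the (complete) Riemannian manifold `(S, g)`: the points `y` for which
some geodesic ray from `x` through `y` is length minimizing up to `y` but not beyond `y`. -/
def cutLocus (S : Set E) (g : E → E → E → ℝ) (x : E) : Set E :=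
  {y | ∃ c : ℝ → E, IsGeodesicOn S g c (Ici 0) ∧ c 0 = x ∧ c 1 = y ∧
    curveLength g c 0 1 = geodesicDist S g x y ∧
    ∀ t > 1, geodesicDist S g x (c t) < curveLength g c 0 t}

end Riemannian

/-- `SO(p)`. -/
def SO (p : ℕ) : Set (Mat p) := {U | U ∈ Matrix.specialOrthogonalGroup (Fin p) ℝ}

/-- `Diag⁺(p)`: the diagonal matrices with positive diagonal entries. -/
def DiagPos (p : ℕ) : Set (Mat p) :=
  {D | ∃ d : Fin p → ℝ, (∀ i, 0 < d i) ∧ D = Matrix.diagonal d}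

/-- `M(p) = SO(p) × Diag⁺(p)`. -/
def M (p : ℕ) : Set (Mat p × Mat p) := SO p ×ˢ DiagPos p

/-- `F(U, D) = U D Uᵀ`. -/
def F {p : ℕ} (q : Mat p × Mat p) : Mat p := q.1 * q.2 * q.1ᵀ

/-- The fiber of `F : M(p) → Sym⁺(p)` over `X`. -/
def fiber {p : ℕ} (X : Mat p) : Set (Mat p × Mat p) := {q | q ∈ M p ∧ F q = X}

/-- The bi-invariant metric on `SO(p)` that is `(A₁, A₂) ↦ -tr(A₁ A₂) / 2` at the identity. -/
noncomputable def gSO {p : ℕ} (U v w : Mat p) : ℝ :=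
  -(1 / 2) * Matrix.trace ((U⁻¹ * v) * (U⁻¹ * w))

/-- The invariant metric `(L₁, L₂) ↦ tr(D⁻¹ L₁ D⁻¹ L₂)` on `Diag⁺(p)`. -/
noncomputable def gDiag {p : ℕ} (D v w : Mat p) : ℝ :=
  Matrix.trace (D⁻¹ * v * D⁻¹ * w)

/-- The product metric `k g_SO ⊕ g_Diag⁺` on `M(p)`. -/
noncomputable def gM {p : ℕ} (k : ℝ) (q v w : Mat p × Mat p) : ℝ :=
  k * gSO q.1 v.1 w.1 + gDiag q.2 v.2 w.2

/-- The geodesic distance of `(M(p), g_M)`. -/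
noncomputable def dM {p : ℕ} (k : ℝ) (q r : Mat p × Mat p) : ℝ :=
  geodesicDist (M p) (gM k) q r

/-- The scaling-rotation distance between `X` and `Y`. -/
noncomputable def dSR {p : ℕ} (k : ℝ) (X Y : Mat p) : ℝ :=
  sInf {d | ∃ q ∈ fiber X, ∃ r ∈ fiber Y, dM k q r = d}

/-- `γ` is, on `[0, 1]`, an `F`-minimal geodesic from the fiber over `X` to the fiber over `Y`. -/
structure IsFMinimal {p : ℕ} (k : ℝ) (X Y : Mat p) (γ : ℝ → Mat p × Mat p) : Prop where
  piecewiseSmooth : IsPiecewiseSmoothIn (M p) γ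
  source : γ 0 ∈ fiber X
  target : γ 1 ∈ fiber Y
  minimal : curveLength (gM k) γ 0 1 = dSR k X Y

/-- `χ = F ∘ γ` on `[0, 1]` is a minimal smooth scaling-rotation curve from `X` to `Y`, presented by
the (constant speed) `F`-minimal geodesic `γ`, and corresponds to the minimal pair `(q, r)` formed
by the endpoints of `γ`. -/
structure IsMSSRCurve {p : ℕ} (k : ℝ) (X Y : Mat p) (q r : Mat p × Mat p)
    (γ : ℝ → Mat p × Mat p) (χ : ℝ → Mat p) : Prop where
  isGeodesic : IsGeodesicOn (M p) (gM k) γ (Icc 0 1)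
  isFMinimal : IsFMinimal k X Y γ
  source_eq : γ 0 = q
  target_eq : γ 1 = r
  eq_comp : ∀ t ∈ Icc (0 : ℝ) 1, χ t = F (γ t)

/-- The pair `(U, V)` in `SO(p) × SO(p)` is geodesically antipodal: one of the two points lies in
the cut locus of the other. -/
def GeodesicallyAntipodal {p : ℕ} (U V : Mat p) : Prop :=
  V ∈ cutLocus (SO p) gSO U ∨ U ∈ cutLocus (SO p) gSO V

/-- The stabilizer `G_D` of `D` under the action `(R, X) ↦ R X Rᵀ` of `SO(p)`. -/
def stab {p : ℕ} (D : Mat p) : Set (Mat p) := {R | R ∈ SO p ∧ R * D * Rᵀ = D}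

/-- The identity component `G_D⁰` of `G_D`. -/
def stabZero {p : ℕ} (D : Mat p) : Set (Mat p) := connectedComponentIn (stab D) 1

/-- The identity component `G_{D,Λ}⁰` of `G_{D,Λ} = G_D ∩ G_Λ`. -/
def stabZero₂ {p : ℕ} (D Λ : Mat p) : Set (Mat p) := connectedComponentIn (stab D ∩ stab Λ) 1

/-- Even signed permutations `g = (σ, π)`: signs `σ` and a permutation `π` with
`(∏ i, σ i) * sgn π = 1`.  The underlying permutation `π_g` is `g.perm`. -/
structure EvenSignedPerm (p : ℕ) where
  sign : Fin p → ℤˣ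
  perm : Equiv.Perm (Fin p)
  even : (∏ i, sign i) * Equiv.Perm.sign perm = 1

/-- The signed-permutation matrix `P_g`, with `P_g e_j = σ_{π(j)} e_{π(j)}`. -/
def EvenSignedPerm.mat {p : ℕ} (g : EvenSignedPerm p) : Mat p :=
  Matrix.of fun i j => if i = g.perm j then (((g.sign i : ℤˣ) : ℤ) : ℝ) else 0

/-- The action of a permutation on diagonal matrices:
`π • diag(d₁, …, d_p) = diag(d_{π⁻¹(1)}, …, d_{π⁻¹(p)})`. -/
def permAct {p : ℕ} (π : Equiv.Perm (Fin p)) (D : Mat p) : Mat p :=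
  Matrix.diagonal fun i => D (π.symm i) (π.symm i)

end ScalingRotation

open ScalingRotation

/-!
Both directions rest on an explicit description of the minimal geodesics. Left-translate velocities
in `M(p)` to the identity. If a curve is multiplied on the right by `exp (θ(t) a)`, invariance of
the metric under conjugation makes its squared speed an exact quadratic polynomial in `θ'`
(`gM_perturb`). Comparing length with energy, minimality then yields the first variation formula
without any analysis of remainders (`integral_mul_lieForm_eq_zero`). Profiles `θ` that vanish at
both ends show that the translated velocity of a minimal geodesic is constant, so that the geodesic
is `t ↦ (W exp (t A), diag (d e^{t l}))` (`exists_eq_expCurve_of_minimal`); the profile `θ(t) = t`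
moves the endpoint within its fiber and shows that `A` is orthogonal to every skew-symmetric matrix
that commutes with `Λ` (`IsMSSRCurve.exists_eq_expCurve`).

Suppose that `χ₁ = χ₂`, and put `Q = R_{U,1}⁻¹ R_{U,2}`. For each `t` the matrix
`N(t) = exp (-t A₁) Q exp (t A₂)` conjugates one diagonal part into the other. By the pigeonhole
principle a single permutation `σ` matches the two families of eigenvalues, and `N(t) i j` vanishes
unless `i` and `σ j` have the same eigenvalue function. The same is therefore true of `N(0) = Q`
and of `N'(0)` (`exists_perm_of_conj_family`). So `A₂ - Qᵀ A₁ Q` is a block matrix, hence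
orthogonal to itself by the orthogonality to the fibers, hence zero (`conj_eq_of_block`); this is
condition (b), which implies (a) by exponentiating. Condition (ii) follows from the fact that a
block orthogonal matrix lies, up to a diagonal matrix of signs, in the identity component of the
block special orthogonal group; Householder reflections prove it
(`exists_mul_signMat_mem_component`). The two pairs of endpoints differ by right translation by `Q`,
an isometry of `SO(p)`, so that one pair is antipodal exactly if the other is.

Conversely, (ii) together with `A₂ = Qᵀ A₁ Q` gives `χ₁ = χ₂` by substitution
(`eqOn_of_velocity_conj`). Condition (b) is this relation. Condition (a) is its exponential; if
`A₁ ≠ Q A₂ Qᵀ`, there are two distinct one-parameter subgroups of equal speed from `U R_{U,1}` to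
the same point. Both are shortest in `SO(p)`, because the two factors of a shortest curve in a
product are shortest (`sqrt_le_curveLength_gSO`). Cutting the corner between them shows that their
common endpoint lies in the cut locus (`mul_exp_mem_cutLocus`).
-/

section

-- The calculus of the matrix exponential needs the normed algebra structure of the same norm.
attribute [local instance] Matrix.frobeniusNormedRing Matrix.frobeniusNormedAlgebra

open NormedSpace (exp)

/-! ### Length and distance on a submanifold of a normed space -/

namespace ScalingRotation

section Riemannian

variable {E : Type*} [NormedAddCommGroup E] [NormedSpace ℝ E]
  {S : Set E} {g : E → E → E → ℝ} {γ η c : ℝ → E} {a b : ℝ}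

theorem curveLength_nonneg (hab : a ≤ b) : 0 ≤ curveLength g γ a b :=
  intervalIntegral.integral_nonneg hab fun _ _ => Real.sqrt_nonneg _

theorem curveLength_congr (hab : a ≤ b) (h : EqOn γ η (Ioo a b)) :
    curveLength g γ a b = curveLength g η a b := by
  refine intervalIntegral.integral_congr_Ioo_of_le hab fun t ht => ?_
  have hd : deriv γ t = deriv η t :=
    Filter.EventuallyEq.deriv_eq (Filter.eventuallyEq_of_mem (Ioo_mem_nhds ht.1 ht.2) h)
  simp only [hd, h ht]

theorem curveLength_eq_integral (hab : a ≤ b) {v : ℝ → E} {f : ℝ → ℝ}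
    (hv : ∀ t ∈ Ioo a b, HasDerivWithinAt γ (v t) (Icc a b) t)
    (hf : ∀ t ∈ Ioo a b, g (γ t) (v t) (v t) = f t) :
    curveLength g γ a b = ∫ t in a..b, Real.sqrt (f t) := by
  refine intervalIntegral.integral_congr_Ioo_of_le hab fun t ht => ?_
  have h := (hv t ht).hasDerivAt (Icc_mem_nhds ht.1 ht.2)
  simp only [h.deriv, hf t ht]

theorem deriv_comp_affine (r d u : ℝ) :
    deriv (fun u => γ (r * u + d)) u = r • deriv γ (r * u + d) := by
  have := deriv_comp_mul_left r (fun x => γ (x + d)) u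
  rw [this, deriv_comp_add_const]

theorem curveLength_comp_affine (hg : ∀ x (r : ℝ) v, g x (r • v) (r • v) = r ^ 2 * g x v v)
    {r : ℝ} (hr : 0 < r) (d : ℝ) :
    curveLength g (fun u => γ (r * u + d)) a b = curveLength g γ (r * a + d) (r * b + d) := by
  have h := intervalIntegral.integral_comp_mul_add (a := a) (b := b)
    (fun t => Real.sqrt (g (γ t) (deriv γ t) (deriv γ t))) hr.ne' d
  have h' : curveLength g (fun u => γ (r * u + d)) a b =
      ∫ u in a..b, r * Real.sqrt (g (γ (r * u + d)) (deriv γ (r * u + d))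
        (deriv γ (r * u + d))) := by
    unfold curveLength
    congr 1
    funext u
    rw [deriv_comp_affine, hg, Real.sqrt_mul (sq_nonneg r), Real.sqrt_sq hr.le]
  rw [h', intervalIntegral.integral_const_mul, h, smul_eq_mul, ← mul_assoc, mul_inv_cancel₀ hr.ne',
    one_mul]
  rfl

theorem geodesicDist_le_curveLength (h : IsPiecewiseSmoothIn S γ) :
    geodesicDist S g (γ 0) (γ 1) ≤ curveLength g γ 0 1 := by
  refine csInf_le ⟨0, ?_⟩ ⟨γ, h, rfl, rfl, rfl⟩
  rintro _ ⟨γ, -, -, -, rfl⟩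
  exact curveLength_nonneg zero_le_one

theorem geodesicDist_nonneg (x y : E) : 0 ≤ geodesicDist S g x y := by
  refine Real.sInf_nonneg ?_
  rintro _ ⟨γ, -, -, -, rfl⟩
  exact curveLength_nonneg zero_le_one

theorem isPiecewiseSmoothIn_of_contDiffOn (h : ContDiffOn ℝ ∞ γ (Icc 0 1))
    (hS : MapsTo γ (Icc 0 1) S) : IsPiecewiseSmoothIn S γ := by
  refine ⟨hS, 1, ![0, 1], ?_, rfl, rfl, ?_⟩
  · rw [Fin.strictMono_iff_lt_succ]
    intro i
    fin_cases i
    simp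
  · intro i
    fin_cases i
    simpa using h

theorem mapsTo_affine (hab : a < b) :
    MapsTo (fun u : ℝ => (b - a) * u + a) (Icc 0 1) (Icc a b) := by
  intro u hu
  have h1 := mul_nonneg (sub_nonneg.2 hab.le) hu.1
  have h2 := mul_nonneg (sub_nonneg.2 hab.le) (sub_nonneg.2 hu.2)
  constructor <;> nlinarith

theorem geodesicDist_le_of_contDiffOn
    (hg : ∀ x (r : ℝ) v, g x (r • v) (r • v) = r ^ 2 * g x v v) (hab : a < b)
    (h : ContDiffOn ℝ ∞ γ (Icc a b)) (hS : MapsTo γ (Icc a b) S) :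
    geodesicDist S g (γ a) (γ b) ≤ curveLength g γ a b := by
  have hm := mapsTo_affine hab
  have h1 : IsPiecewiseSmoothIn S (fun u => γ ((b - a) * u + a)) :=
    isPiecewiseSmoothIn_of_contDiffOn (h.comp (by fun_prop) hm) (hS.comp hm)
  have h2 := geodesicDist_le_curveLength (g := g) h1
  rw [curveLength_comp_affine hg (sub_pos.2 hab)] at h2
  simpa using h2

/-- The speed of a smooth curve is integrable. The two one-sided derivatives at the endpoints do
not matter, so that the total derivative may be used. -/
theorem intervalIntegrable_speed_of_contDiffOn
    (hgc : ContinuousOn (fun z : E × E => g z.1 z.2 z.2) (S ×ˢ univ)) (hab : a ≤ b)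
    (h : ContDiffOn ℝ ∞ γ (Icc a b)) (hS : MapsTo γ (Icc a b) S) :
    IntervalIntegrable (fun t => Real.sqrt (g (γ t) (deriv γ t) (deriv γ t)))
      MeasureTheory.volume a b := by
  rcases hab.eq_or_lt with rfl | hab'
  · exact IntervalIntegrable.refl
  have hd : ContinuousOn (derivWithin γ (Icc a b)) (Icc a b) :=
    h.continuousOn_derivWithin (uniqueDiffOn_Icc hab') (by simp)
  have hc : ContinuousOn (fun t => Real.sqrt
      (g (γ t) (derivWithin γ (Icc a b) t) (derivWithin γ (Icc a b) t))) (Icc a b) := by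
    refine Real.continuous_sqrt.comp_continuousOn ?_
    exact hgc.comp (h.continuousOn.prodMk hd) fun t ht => ⟨hS ht, mem_univ _⟩
  have hi := hc.intervalIntegrable_of_Icc (μ := MeasureTheory.volume) hab
  refine hi.congr_uIoo fun t ht => ?_
  rw [uIoo_of_le hab] at ht
  simp only [derivWithin_of_mem_nhds (Icc_mem_nhds ht.1 ht.2)]

/-- Integrability over `[0, 1]` can be checked on the intervals of a subdivision. -/
theorem intervalIntegrable_of_subdivision {n : ℕ} {t : Fin (n + 1) → ℝ} {f : ℝ → ℝ}
    (h0 : t 0 = 0) (h1 : t (Fin.last n) = 1)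
    (h : ∀ i : Fin n, IntervalIntegrable f MeasureTheory.volume (t i.castSucc) (t i.succ)) :
    IntervalIntegrable f MeasureTheory.volume 0 1 := by
  have key : ∀ i : Fin (n + 1), IntervalIntegrable f MeasureTheory.volume (t 0) (t i) := by
    intro i
    induction i using Fin.induction with
    | zero => exact IntervalIntegrable.refl
    | succ i ih => exact ih.trans (h i)
  have := key (Fin.last n)
  rwa [h0, h1] at this

theorem IsPiecewiseSmoothIn.subdivision_subset {n : ℕ} {t : Fin (n + 1) → ℝ} (hm : StrictMono t)
    (h0 : t 0 = 0) (h1 : t (Fin.last n) = 1) (i : Fin n) :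
    Icc (t i.castSucc) (t i.succ) ⊆ Icc 0 1 := by
  refine Icc_subset_Icc ?_ ?_
  · rw [← h0]; exact hm.monotone (Fin.zero_le _)
  · rw [← h1]; exact hm.monotone (Fin.le_last _)

theorem IsPiecewiseSmoothIn.intervalIntegrable_speed
    (hgc : ContinuousOn (fun z : E × E => g z.1 z.2 z.2) (S ×ˢ univ))
    (h : IsPiecewiseSmoothIn S γ) :
    IntervalIntegrable (fun t => Real.sqrt (g (γ t) (deriv γ t) (deriv γ t)))
      MeasureTheory.volume 0 1 := by
  obtain ⟨hS, n, t, hm, h0, h1, hs⟩ := h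
  refine intervalIntegrable_of_subdivision h0 h1 fun i => ?_
  exact intervalIntegrable_speed_of_contDiffOn hgc (hm i.castSucc_lt_succ).le (hs i)
    (hS.mono_left (IsPiecewiseSmoothIn.subdivision_subset hm h0 h1 i))

/-- Appending a smooth piece to a piecewise smooth curve: the form of the triangle inequality
that is needed for corner cutting. -/
theorem geodesicDist_le_add
    (hg : ∀ x (r : ℝ) v, g x (r • v) (r • v) = r ^ 2 * g x v v)
    (hgc : ContinuousOn (fun z : E × E => g z.1 z.2 z.2) (S ×ˢ univ))
    (hη : IsPiecewiseSmoothIn S η) (hab : a < b) (hc : ContDiffOn ℝ ∞ c (Icc a b))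
    (hcS : MapsTo c (Icc a b) S) (hηc : η 1 = c a) :
    geodesicDist S g (η 0) (c b) ≤ curveLength g η 0 1 + curveLength g c a b := by
  set ζ : ℝ → E := fun u => if u ≤ 1 / 2 then η (2 * u + 0)
    else c (2 * (b - a) * u + (2 * a - b)) with hζ
  have hl : ∀ u ≤ 1 / 2, ζ u = η (2 * u + 0) := fun u hu => if_pos hu
  have hr : ∀ u, 1 / 2 ≤ u → ζ u = c (2 * (b - a) * u + (2 * a - b)) := by
    intro u hu
    rcases hu.eq_or_lt with rfl | hu
    · rw [hl _ le_rfl]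
      have e1 : 2 * (1 / 2 : ℝ) + 0 = 1 := by norm_num
      have e2 : 2 * (b - a) * (1 / 2) + (2 * a - b) = a := by ring
      rw [e1, e2, hηc]
    · exact if_neg (not_le.2 hu)
  have hm : MapsTo (fun u : ℝ => 2 * (b - a) * u + (2 * a - b)) (Icc (1 / 2) 1) (Icc a b) := by
    intro u hu
    have h1 := mul_nonneg (sub_nonneg.2 hab.le) (sub_nonneg.2 hu.1)
    have h2 := mul_nonneg (sub_nonneg.2 hab.le) (sub_nonneg.2 hu.2)
    constructor <;> nlinarith
  have hζp : IsPiecewiseSmoothIn S ζ := by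
    obtain ⟨hS, n, t, hmt, h0, h1, hs⟩ := hη
    refine ⟨?_, n + 1, Fin.snoc (fun i => t i / 2) 1, ?_, ?_, ?_, ?_⟩
    · intro u hu
      rcases le_total u (1 / 2) with h | h
      · rw [hl u h]
        exact hS ⟨by linarith [hu.1], by linarith⟩
      · rw [hr u h]
        exact hcS (hm ⟨h, hu.2⟩)
    · rw [Fin.strictMono_iff_lt_succ]
      intro i
      induction i using Fin.lastCases with
      | last =>
        rw [Fin.succ_last, Fin.snoc_last, Fin.snoc_castSucc, h1]
        norm_num
      | cast i =>
        rw [Fin.snoc_castSucc, Fin.succ_castSucc, Fin.snoc_castSucc]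
        have := hmt i.castSucc_lt_succ
        linarith
    · rw [← Fin.castSucc_zero, Fin.snoc_castSucc, h0]
      norm_num
    · rw [Fin.snoc_last]
    · intro i
      induction i using Fin.lastCases with
      | last =>
        rw [Fin.succ_last, Fin.snoc_last, Fin.snoc_castSucc, h1]
        refine ContDiffOn.congr (hc.comp (by fun_prop) hm) fun u hu => hr u hu.1
      | cast i =>
        rw [Fin.snoc_castSucc, Fin.succ_castSucc, Fin.snoc_castSucc]
        have hle : t i.succ ≤ 1 := by rw [← h1]; exact hmt.monotone (Fin.le_last _)
        refine ContDiffOn.congr ((hs i).comp (f := fun u => 2 * u + 0) (by fun_prop) ?_)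
          fun u hu => hl u (by linarith [hu.2])
        intro u hu
        exact ⟨by linarith [hu.1], by linarith [hu.2]⟩
  have hint := hζp.intervalIntegrable_speed hgc
  have hlen : curveLength g ζ 0 1 = curveLength g η 0 1 + curveLength g c a b := by
    have hsub : ∀ x y : ℝ, 0 ≤ x → x ≤ y → y ≤ 1 → uIcc x y ⊆ uIcc 0 1 := by
      intro x y hx hxy hy
      rw [uIcc_of_le hxy, uIcc_of_le zero_le_one]
      exact Icc_subset_Icc hx hy
    have hadd : curveLength g ζ 0 1 = curveLength g ζ 0 (1 / 2) + curveLength g ζ (1 / 2) 1 :=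
      (intervalIntegral.integral_add_adjacent_intervals
        (hint.mono_set (hsub _ _ le_rfl (by norm_num) (by norm_num)))
        (hint.mono_set (hsub _ _ (by norm_num) (by norm_num) le_rfl))).symm
    rw [hadd, curveLength_congr (by norm_num) (fun u hu => hl u hu.2.le),
      curveLength_congr (by norm_num) (fun u hu => hr u hu.1.le),
      curveLength_comp_affine hg two_pos, curveLength_comp_affine hg (by linarith)]
    congr 2 <;> ring
  have h := geodesicDist_le_curveLength (g := g) hζp
  rw [hl 0 (by norm_num), hr 1 (by norm_num), hlen] at h
  convert h using 3 <;> ring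

theorem geodesicDist_triangle_of_contDiffOn
    (hg : ∀ x (r : ℝ) v, g x (r • v) (r • v) = r ^ 2 * g x v v)
    (hgc : ContinuousOn (fun z : E × E => g z.1 z.2 z.2) (S ×ˢ univ)) {x : E}
    (hx : ∃ η, IsPiecewiseSmoothIn S η ∧ η 0 = x ∧ η 1 = c a) (hab : a < b)
    (hc : ContDiffOn ℝ ∞ c (Icc a b)) (hcS : MapsTo c (Icc a b) S) :
    geodesicDist S g x (c b) ≤ geodesicDist S g x (c a) + curveLength g c a b := by
  rw [← sub_le_iff_le_add]
  obtain ⟨η, hη, h0, h1⟩ := hx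
  refine le_csInf ⟨_, η, hη, h0, h1, rfl⟩ ?_
  rintro _ ⟨ζ, hζ, rfl, hζ1, rfl⟩
  exact sub_le_iff_le_add.2 (geodesicDist_le_add hg hgc hζ hab hc hcS hζ1)

section Isometry

variable (Φ : E ≃L[ℝ] E)

theorem deriv_comp_equiv (t : ℝ) : deriv (Φ ∘ γ) t = Φ (deriv γ t) := by
  rw [← fderiv_apply_one_eq_deriv, ContinuousLinearEquiv.comp_fderiv]
  simp

theorem derivWithin_comp_equiv {I : Set ℝ} {t : ℝ} (hI : UniqueDiffWithinAt ℝ I t) :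
    derivWithin (Φ ∘ γ) I t = Φ (derivWithin γ I t) := by
  rw [← fderivWithin_derivWithin, ContinuousLinearEquiv.comp_fderivWithin _ hI]
  simp [fderivWithin_derivWithin]

theorem curveLength_comp_equiv (hg : ∀ x v, g (Φ x) (Φ v) (Φ v) = g x v v) :
    curveLength g (Φ ∘ γ) a b = curveLength g γ a b := by
  unfold curveLength
  simp only [deriv_comp_equiv, Function.comp_apply, hg]

end Isometry

theorem IsPiecewiseSmoothIn.comp_equiv (Φ : E ≃L[ℝ] E) (hS : ∀ x ∈ S, Φ x ∈ S)
    (h : IsPiecewiseSmoothIn S γ) : IsPiecewiseSmoothIn S (Φ ∘ γ) := by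
  obtain ⟨hm, n, t, ht, h0, h1, hs⟩ := h
  exact ⟨fun u hu => hS _ (hm hu), n, t, ht, h0, h1,
    fun i => Φ.contDiff.comp_contDiffOn (hs i)⟩

theorem geodesicDist_equiv (Φ : E ≃L[ℝ] E) (hg : ∀ x v, g (Φ x) (Φ v) (Φ v) = g x v v)
    (hS : ∀ x, Φ x ∈ S ↔ x ∈ S) (x y : E) :
    geodesicDist S g (Φ x) (Φ y) = geodesicDist S g x y := by
  unfold geodesicDist
  congr 1
  ext ℓ
  constructor
  · rintro ⟨γ, h, h0, h1, rfl⟩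
    refine ⟨Φ.symm ∘ γ, h.comp_equiv Φ.symm fun x hx => ?_, by simp [h0], by simp [h1], ?_⟩
    · rw [← hS]; simpa using hx
    · rw [← curveLength_comp_equiv Φ hg]
      congr 1
      ext t
      simp
  · rintro ⟨γ, h, h0, h1, rfl⟩
    exact ⟨Φ ∘ γ, h.comp_equiv Φ fun x hx => (hS x).2 hx, by simp [h0], by simp [h1],
      curveLength_comp_equiv Φ hg⟩

theorem IsGeodesicOn.comp_equiv (Φ : E ≃L[ℝ] E) (hg : ∀ x v, g (Φ x) (Φ v) (Φ v) = g x v v)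
    (hS : ∀ x, Φ x ∈ S ↔ x ∈ S) {I : Set ℝ} (hI : UniqueDiffOn ℝ I) (h : IsGeodesicOn S g c I) :
    IsGeodesicOn S g (Φ ∘ c) I where
  mapsTo t ht := (hS _).2 (h.mapsTo ht)
  smooth := Φ.contDiff.comp_contDiffOn h.smooth
  constSpeed := by
    obtain ⟨v, hv⟩ := h.constSpeed
    refine ⟨v, fun t ht => ?_⟩
    rw [derivWithin_comp_equiv Φ (hI t ht), Function.comp_apply, hg, hv t ht]
  locallyMinimizing t ht := by
    obtain ⟨ε, hε, H⟩ := h.locallyMinimizing t ht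
    refine ⟨ε, hε, fun a ha b hb hat hbt hab => ?_⟩
    rw [curveLength_comp_equiv Φ hg, Function.comp_apply, Function.comp_apply,
      geodesicDist_equiv Φ hg hS, H a ha b hb hat hbt hab]

theorem mem_cutLocus_of_equiv (Φ : E ≃L[ℝ] E) (hg : ∀ x v, g (Φ x) (Φ v) (Φ v) = g x v v)
    (hS : ∀ x, Φ x ∈ S ↔ x ∈ S) {x y : E} (h : y ∈ cutLocus S g x) :
    Φ y ∈ cutLocus S g (Φ x) := by
  obtain ⟨c, hc, h0, h1, hmin, hcut⟩ := h
  refine ⟨Φ ∘ c, hc.comp_equiv Φ hg hS (uniqueDiffOn_Ici 0), by simp [h0], by simp [h1], ?_, ?_⟩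
  · rw [curveLength_comp_equiv Φ hg, geodesicDist_equiv Φ hg hS, hmin]
  · intro t ht
    rw [curveLength_comp_equiv Φ hg, Function.comp_apply, geodesicDist_equiv Φ hg hS]
    exact hcut t ht

end Riemannian

end ScalingRotation

/-! ### The groups `SO(p)` and `Diag⁺(p)` and perturbations of curves -/

namespace ScalingRotation

variable {p : ℕ} {k : ℝ}

section Groups

theorem mem_SO_iff {U : Mat p} : U ∈ SO p ↔ U * Uᵀ = 1 ∧ U.det = 1 := by
  unfold SO
  rw [mem_ofPred_eq, Matrix.mem_specialOrthogonalGroup_iff, Matrix.mem_orthogonalGroup_iff]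

theorem SO.mul_transpose {U : Mat p} (h : U ∈ SO p) : U * Uᵀ = 1 := (mem_SO_iff.1 h).1

theorem SO.transpose_mul {U : Mat p} (h : U ∈ SO p) : Uᵀ * U = 1 :=
  mul_eq_one_comm.1 (SO.mul_transpose h)

theorem SO.inv_eq {U : Mat p} (h : U ∈ SO p) : U⁻¹ = Uᵀ :=
  Matrix.inv_eq_right_inv (SO.mul_transpose h)

theorem SO.isUnit {U : Mat p} (h : U ∈ SO p) : IsUnit U :=
  IsUnit.of_mul_eq_one _ (SO.mul_transpose h)

theorem SO.isUnit_det {U : Mat p} (h : U ∈ SO p) : IsUnit U.det :=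
  (Matrix.isUnit_iff_isUnit_det _).1 (SO.isUnit h)

theorem SO.mul_mem {U V : Mat p} (hU : U ∈ SO p) (hV : V ∈ SO p) : U * V ∈ SO p := by
  rw [mem_SO_iff] at *
  refine ⟨?_, by rw [Matrix.det_mul, hU.2, hV.2, one_mul]⟩
  rw [Matrix.transpose_mul, mul_assoc, ← mul_assoc V, hV.1, one_mul, hU.1]

theorem SO.transpose_mem {U : Mat p} (hU : U ∈ SO p) : Uᵀ ∈ SO p := by
  refine mem_SO_iff.2 ⟨?_, by rw [Matrix.det_transpose, (mem_SO_iff.1 hU).2]⟩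
  rw [Matrix.transpose_transpose, SO.transpose_mul hU]

theorem SO.inv_mem {U : Mat p} (hU : U ∈ SO p) : U⁻¹ ∈ SO p := by
  rw [SO.inv_eq hU]
  exact SO.transpose_mem hU

theorem DiagPos.isUnit {D : Mat p} (h : D ∈ DiagPos p) : IsUnit D := by
  obtain ⟨d, hd, rfl⟩ := h
  rw [Matrix.isUnit_diagonal, Pi.isUnit_iff]
  exact fun i => (hd i).ne'.isUnit

theorem DiagPos.mul_mem {D D' : Mat p} (h : D ∈ DiagPos p) (h' : D' ∈ DiagPos p) :
    D * D' ∈ DiagPos p := by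
  obtain ⟨d, hd, rfl⟩ := h
  obtain ⟨d', hd', rfl⟩ := h'
  exact ⟨_, fun i => mul_pos (hd i) (hd' i), Matrix.diagonal_mul_diagonal _ _⟩

theorem exp_diagonal_eq (l : Fin p → ℝ) :
    exp (Matrix.diagonal l) = Matrix.diagonal fun i => Real.exp (l i) := by
  rw [Matrix.exp_diagonal]
  congr 1
  funext i
  rw [Pi.coe_exp, Real.exp_eq_exp_ℝ]

theorem exp_diagonal_mem (l : Fin p → ℝ) : exp (Matrix.diagonal l) ∈ DiagPos p :=
  ⟨_, fun _ => Real.exp_pos _, exp_diagonal_eq l⟩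

theorem transpose_exp_of_skew {A : Mat p} (hA : Aᵀ = -A) : (exp A)ᵀ = (exp A)⁻¹ := by
  rw [← Matrix.exp_transpose, hA, Matrix.exp_neg]

theorem exp_mul_inv (A : Mat p) : exp A * (exp A)⁻¹ = 1 :=
  Matrix.mul_nonsing_inv _ ((Matrix.isUnit_iff_isUnit_det _).1 (Matrix.isUnit_exp A))

theorem exp_inv_mul (A : Mat p) : (exp A)⁻¹ * exp A = 1 :=
  Matrix.nonsing_inv_mul _ ((Matrix.isUnit_iff_isUnit_det _).1 (Matrix.isUnit_exp A))

theorem exp_skew_mem {A : Mat p} (hA : Aᵀ = -A) : exp A ∈ SO p := by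
  have h1 : ∀ {B : Mat p}, Bᵀ = -B → exp B * (exp B)ᵀ = 1 := fun hB => by
    rw [transpose_exp_of_skew hB, exp_mul_inv]
  refine mem_SO_iff.2 ⟨h1 hA, ?_⟩
  -- The determinant is a square, as `exp A` is the square of `exp (A / 2)`.
  have h2 : exp A = exp ((1 / 2 : ℝ) • A) * exp ((1 / 2 : ℝ) • A) := by
    rw [← Matrix.exp_add_of_commute _ _ (Commute.refl _), ← add_smul]
    norm_num
  have h3 := congrArg Matrix.det (h1 (B := (1 / 2 : ℝ) • A) (by simp [hA]))
  rw [Matrix.det_mul, Matrix.det_transpose, Matrix.det_one] at h3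
  rw [h2, Matrix.det_mul, h3]

end Groups

section Trace

theorem trace_transpose_mul_self_eq_zero {A : Mat p} (h : (Aᵀ * A).trace = 0) : A = 0 := by
  rw [← Matrix.conjTranspose_eq_transpose_of_trivial] at h
  exact Matrix.trace_conjTranspose_mul_self_eq_zero_iff.1 h

theorem trace_transpose_mul_self_nonneg (A : Mat p) : 0 ≤ (Aᵀ * A).trace := by
  rw [Matrix.trace]
  refine Finset.sum_nonneg fun i _ => ?_
  rw [Matrix.diag_apply, Matrix.mul_apply]
  exact Finset.sum_nonneg fun j _ => mul_self_nonneg _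

/-- The tangent space of `SO(p) × Diag⁺(p)` at the identity. -/
def lieAlg (p : ℕ) : Set (Mat p × Mat p) := {a | a.1ᵀ = -a.1 ∧ ∃ l, a.2 = Matrix.diagonal l}

/-- The quadratic form at the identity of `SO(p) × Diag⁺(p)` that induces the metric `gM k`, in
polarized form. -/
noncomputable def lieForm (k : ℝ) (a b : Mat p × Mat p) : ℝ :=
  -(k / 2) * (a.1 * b.1).trace + (a.2 * b.2).trace

/-- Left translation of the vector `v` at `q` to the identity. -/
noncomputable def leftLog (q v : Mat p × Mat p) : Mat p × Mat p := (q.1⁻¹ * v.1, q.2⁻¹ * v.2)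

theorem gM_self (k : ℝ) (q v : Mat p × Mat p) :
    gM k q v v = lieForm k (leftLog q v) (leftLog q v) := by
  simp only [gM, gSO, gDiag, lieForm, leftLog, mul_assoc]
  ring

theorem lieForm_self_nonneg (hk : 0 ≤ k) {a : Mat p × Mat p} (ha : a ∈ lieAlg p) :
    0 ≤ lieForm k a a := by
  obtain ⟨h1, l, h2⟩ := ha
  have e1 : (a.1 * a.1).trace = -(a.1ᵀ * a.1).trace := by rw [h1]; simp
  have e2 : (a.2 * a.2).trace = (a.2ᵀ * a.2).trace := by rw [h2]; simp
  have := mul_nonneg hk (trace_transpose_mul_self_nonneg a.1)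
  have := trace_transpose_mul_self_nonneg a.2
  rw [lieForm, e1, e2]
  linarith

theorem eq_zero_of_lieForm_self_eq_zero (hk : 0 < k) {a : Mat p × Mat p} (ha : a ∈ lieAlg p)
    (h : lieForm k a a = 0) : a = 0 := by
  obtain ⟨h1, l, h2⟩ := ha
  have e1 : (a.1 * a.1).trace = -(a.1ᵀ * a.1).trace := by rw [h1]; simp
  have e2 : (a.2 * a.2).trace = (a.2ᵀ * a.2).trace := by rw [h2]; simp
  have i1 := trace_transpose_mul_self_nonneg a.1
  have i2 := trace_transpose_mul_self_nonneg a.2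
  have i3 := mul_nonneg hk.le i1
  rw [lieForm, e1, e2] at h
  have z1 : k * (a.1ᵀ * a.1).trace = 0 := by linarith
  have z2 : (a.2ᵀ * a.2).trace = 0 := by linarith
  exact Prod.ext (trace_transpose_mul_self_eq_zero ((mul_eq_zero.1 z1).resolve_left hk.ne'))
    (trace_transpose_mul_self_eq_zero z2)

theorem lieForm_sub_left (a b c : Mat p × Mat p) :
    lieForm k (a - b) c = lieForm k a c - lieForm k b c := by
  simp only [lieForm, Prod.fst_sub, Prod.snd_sub, sub_mul, Matrix.trace_sub]
  ring

theorem lieAlg.sub_mem {a b : Mat p × Mat p} (ha : a ∈ lieAlg p) (hb : b ∈ lieAlg p) :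
    a - b ∈ lieAlg p := by
  obtain ⟨h1, l, h2⟩ := ha
  obtain ⟨h1', l', h2'⟩ := hb
  refine ⟨by simp [h1, h1']; abel, fun i => l i - l' i, ?_⟩
  rw [Prod.snd_sub, h2, h2', Matrix.diagonal_sub]

theorem lieAlg.smul_mem (r : ℝ) {a : Mat p × Mat p} (ha : a ∈ lieAlg p) : r • a ∈ lieAlg p := by
  obtain ⟨h1, l, h2⟩ := ha
  exact ⟨by simp [h1], fun i => r * l i, by ext i j; simp [h2, Matrix.diagonal_apply]⟩

/-- Perturbing a curve by a one-parameter subgroup changes its squared speed by an exact quadratic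
polynomial, because the form is invariant under conjugation by the subgroup. -/
theorem trace_sq_conj_add {e B : Mat p} (Ω : Mat p) (he : e * e⁻¹ = 1) (hc : Commute e B)
    (r : ℝ) :
    ((e⁻¹ * Ω * e + r • B) * (e⁻¹ * Ω * e + r • B)).trace =
      (Ω * Ω).trace + 2 * r * (Ω * B).trace + r ^ 2 * (B * B).trace := by
  have h1 : (e⁻¹ * Ω * e * (e⁻¹ * Ω * e)).trace = (Ω * Ω).trace := by
    have : e⁻¹ * Ω * e * (e⁻¹ * Ω * e) = e⁻¹ * (Ω * (e * e⁻¹) * Ω * e) := by noncomm_ring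
    rw [this, Matrix.trace_mul_comm, he, mul_one, mul_assoc, he, mul_one]
  have h2 : (e⁻¹ * Ω * e * B).trace = (Ω * B).trace := by
    have : e⁻¹ * Ω * e * B = e⁻¹ * (Ω * (e * B)) := by noncomm_ring
    rw [this, Matrix.trace_mul_comm, hc.eq, mul_assoc, mul_assoc, he, mul_one]
  rw [add_mul, mul_add, mul_add, Matrix.trace_add, Matrix.trace_add, Matrix.trace_add, h1]
  simp only [mul_smul_comm, smul_mul_assoc, Matrix.trace_smul, smul_eq_mul]
  rw [Matrix.trace_mul_comm B, h2]
  ring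

end Trace

section Metric

theorem gSO_smul (x : Mat p) (r : ℝ) (v : Mat p) : gSO x (r • v) (r • v) = r ^ 2 * gSO x v v := by
  simp only [gSO, mul_smul_comm, smul_mul_assoc, Matrix.trace_smul, smul_eq_mul]
  ring

theorem contDiffAt_inv {A : Mat p} (h : IsUnit A) : ContDiffAt ℝ ∞ (fun B : Mat p => B⁻¹) A := by
  obtain ⟨u, rfl⟩ := h
  have : (fun B : Mat p => B⁻¹) = Ring.inverse := by
    funext B
    exact Matrix.nonsing_inv_eq_ringInverse B
  rw [this]
  exact contDiffAt_ringInverse ℝ u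

theorem contDiffOn_inv : ContDiffOn ℝ ∞ (fun B : Mat p => B⁻¹) {A | IsUnit A} :=
  fun _ h => (contDiffAt_inv h).contDiffWithinAt

theorem contDiff_trace : ContDiff ℝ ∞ (fun A : Mat p => A.trace) :=
  (Matrix.traceLinearMap (Fin p) ℝ ℝ).toContinuousLinearMap.contDiff

theorem continuousOn_gSO :
    ContinuousOn (fun z : Mat p × Mat p => gSO z.1 z.2 z.2) (SO p ×ˢ univ) := by
  have h1 : ContinuousOn (fun z : Mat p × Mat p => z.1⁻¹) (SO p ×ˢ univ) :=
    contDiffOn_inv.continuousOn.comp continuousOn_fst fun z hz => SO.isUnit hz.1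
  have h2 := h1.mul continuousOn_snd
  exact continuousOn_const.mul (contDiff_trace.continuous.comp_continuousOn (h2.mul h2))

theorem continuous_lieForm (k : ℝ) (b : Mat p × Mat p) : Continuous fun a => lieForm k a b := by
  unfold lieForm
  have := (contDiff_trace (p := p)).continuous
  fun_prop

theorem continuousOn_gM :
    ContinuousOn (fun z : (Mat p × Mat p) × (Mat p × Mat p) => gM k z.1 z.2 z.2)
      (M p ×ˢ univ) := by
  have h1 : ContinuousOn (fun z : (Mat p × Mat p) × (Mat p × Mat p) => z.1.1⁻¹ * z.2.1)
      (M p ×ˢ univ) :=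
    (contDiffOn_inv.continuousOn.comp (by fun_prop) fun z hz => SO.isUnit hz.1.1).mul (by fun_prop)
  have h2 : ContinuousOn (fun z : (Mat p × Mat p) × (Mat p × Mat p) => z.1.2⁻¹ * z.2.2)
      (M p ×ˢ univ) :=
    (contDiffOn_inv.continuousOn.comp (by fun_prop) fun z hz => DiagPos.isUnit hz.1.2).mul
      (by fun_prop)
  simp only [gM_self, lieForm, leftLog]
  exact (continuousOn_const.mul (contDiff_trace.continuous.comp_continuousOn (h1.mul h1))).add
    (contDiff_trace.continuous.comp_continuousOn (h2.mul h2))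

end Metric

section Tangent

variable {I : Set ℝ} {t : ℝ}

theorem hasDerivWithinAt_transpose {P : ℝ → Mat p} {P' : Mat p} (h : HasDerivWithinAt P P' I t) :
    HasDerivWithinAt (fun u => (P u)ᵀ) P'ᵀ I t :=
  (Matrix.transposeLinearEquiv (Fin p) (Fin p) ℝ
    ℝ).toLinearMap.toContinuousLinearMap.hasFDerivAt.comp_hasDerivWithinAt t h

theorem hasDerivWithinAt_entry {P : ℝ → Mat p} {P' : Mat p} (h : HasDerivWithinAt P P' I t)
    (i j : Fin p) : HasDerivWithinAt (fun u => P u i j) (P' i j) I t :=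
  (Matrix.entryLinearMap ℝ ℝ i j).toContinuousLinearMap.hasFDerivAt.comp_hasDerivWithinAt t h

/-- Velocities of curves in `M(p)`, translated to the identity, are tangent to `M(p)` there. -/
theorem leftLog_mem_lieAlg {γ : ℝ → Mat p × Mat p} {v : Mat p × Mat p}
    (hI : UniqueDiffWithinAt ℝ I t) (ht : t ∈ I) (hM : MapsTo γ I (M p))
    (h : HasDerivWithinAt γ v I t) : leftLog (γ t) v ∈ lieAlg p := by
  have h1 : HasDerivWithinAt (fun u => (γ u).1) v.1 I t := h.fst
  have h2 : HasDerivWithinAt (fun u => (γ u).2) v.2 I t := h.snd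
  obtain ⟨hU, d, hd, hD⟩ := hM ht
  constructor
  · have e1 : HasDerivWithinAt (fun _ => (1 : Mat p)) (v.1ᵀ * (γ t).1 + (γ t).1ᵀ * v.1) I t := by
      refine ((hasDerivWithinAt_transpose h1).mul h1).congr_of_mem (fun u hu => ?_) ht
      exact (SO.transpose_mul (hM hu).1).symm
    have e2 := hI.eq_deriv I e1 (hasDerivWithinAt_const t I (1 : Mat p))
    simp only [leftLog, SO.inv_eq hU, Matrix.transpose_mul, Matrix.transpose_transpose]
    exact eq_neg_of_add_eq_zero_left e2
  · refine ⟨fun i => (d i)⁻¹ * v.2 i i, ?_⟩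
    have e3 : v.2 = Matrix.diagonal fun i => v.2 i i := by
      ext i j
      by_cases hij : i = j
      · subst hij; simp
      · rw [Matrix.diagonal_apply_ne _ hij]
        refine hI.eq_deriv I (hasDerivWithinAt_entry h2 i j)
          ((hasDerivWithinAt_const t I (0 : ℝ)).congr_of_mem (fun u hu => ?_) ht)
        obtain ⟨d', -, hD'⟩ := (hM hu).2
        simp only [hD']
        exact Matrix.diagonal_apply_ne _ hij
    have e4 : (γ t).2⁻¹ = Matrix.diagonal fun i => (d i)⁻¹ := by
      rw [hD]
      refine Matrix.inv_eq_right_inv ?_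
      rw [Matrix.diagonal_mul_diagonal]
      simp [fun i => (hd i).ne']
    simp only [leftLog, e4]
    rw [e3, Matrix.diagonal_mul_diagonal]
    simp

end Tangent

section Exponential

theorem contDiff_exp_mat : ContDiff ℝ ∞ (fun A : Mat p => exp A) := by
  rw [contDiff_iff_contDiffAt]
  exact fun A => (NormedSpace.exp_analytic (𝕂 := ℝ) A).contDiffAt

theorem hasDerivAt_exp_smul (B : Mat p) (r : ℝ) :
    HasDerivAt (fun u : ℝ => exp (u • B)) (exp (r • B) * B) r :=
  hasDerivAt_exp_smul_const B r

theorem commute_exp_smul (B : Mat p) (r : ℝ) : Commute (exp (r • B)) B :=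
  ((Commute.refl B).smul_left r).exp_left

/-- The perturbation of the curve `γ` in the direction `a` with profile `θ`. -/
noncomputable def perturb (γ : ℝ → Mat p × Mat p) (θ : ℝ → ℝ) (a : Mat p × Mat p) (t : ℝ) :
    Mat p × Mat p :=
  ((γ t).1 * exp (θ t • a.1), (γ t).2 * exp (θ t • a.2))

variable {γ : ℝ → Mat p × Mat p} {θ : ℝ → ℝ} {a : Mat p × Mat p} {I : Set ℝ}

theorem mapsTo_perturb (hM : MapsTo γ I (M p)) (ha : a ∈ lieAlg p) :
    MapsTo (perturb γ θ a) I (M p) := by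
  intro t ht
  obtain ⟨h1, l, h2⟩ := lieAlg.smul_mem (θ t) ha
  refine ⟨SO.mul_mem (hM ht).1 (exp_skew_mem h1), DiagPos.mul_mem (hM ht).2 ?_⟩
  rw [Prod.smul_snd] at h2
  rw [h2]
  exact exp_diagonal_mem l

theorem contDiffOn_perturb (hγ : ContDiffOn ℝ ∞ γ I) (hθ : ContDiffOn ℝ ∞ θ I) :
    ContDiffOn ℝ ∞ (perturb γ θ a) I := by
  have he : ∀ B : Mat p, ContDiffOn ℝ ∞ (fun t => exp (θ t • B)) I := fun B =>
    contDiff_exp_mat.comp_contDiffOn (hθ.smul contDiffOn_const)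
  exact (hγ.fst.mul (he _)).prodMk (hγ.snd.mul (he _))

theorem hasDerivWithinAt_mul_exp {P : ℝ → Mat p} {P' : Mat p} {θ' t : ℝ} (B : Mat p)
    (hP : HasDerivWithinAt P P' I t) (hθ : HasDerivWithinAt θ θ' I t) :
    HasDerivWithinAt (fun u => P u * exp (θ u • B))
      (P' * exp (θ t • B) + P t * (θ' • (exp (θ t • B) * B))) I t :=
  hP.mul ((hasDerivAt_exp_smul B (θ t)).scomp_hasDerivWithinAt t hθ)

theorem leftLog_mul_exp {P P' B : Mat p} (hP : IsUnit P) (r θ' : ℝ) :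
    (P * exp (r • B))⁻¹ * (P' * exp (r • B) + P * (θ' • (exp (r • B) * B))) =
      (exp (r • B))⁻¹ * (P⁻¹ * P') * exp (r • B) + θ' • B := by
  have h1 : P⁻¹ * P = 1 := Matrix.nonsing_inv_mul _ ((Matrix.isUnit_iff_isUnit_det _).1 hP)
  have h2 := exp_inv_mul (r • B)
  rw [Matrix.mul_inv_rev, mul_add]
  congr 1
  · simp only [mul_assoc]
  · rw [mul_smul_comm, mul_smul_comm]
    congr 1
    calc (exp (r • B))⁻¹ * P⁻¹ * (P * (exp (r • B) * B))
        = (exp (r • B))⁻¹ * (P⁻¹ * P) * exp (r • B) * B := by noncomm_ring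
      _ = B := by rw [h1, mul_one, h2, one_mul]

/-- The velocity of `perturb γ θ a` at a time when `γ` has velocity `v` and `θ` has
derivative `θ'`. -/
noncomputable def perturbVelocity (q : Mat p × Mat p) (r : ℝ) (a v : Mat p × Mat p) (θ' : ℝ) :
    Mat p × Mat p :=
  (v.1 * exp (r • a.1) + q.1 * (θ' • (exp (r • a.1) * a.1)),
    v.2 * exp (r • a.2) + q.2 * (θ' • (exp (r • a.2) * a.2)))

theorem hasDerivWithinAt_perturb {v : Mat p × Mat p} {θ' t : ℝ} (hγ : HasDerivWithinAt γ v I t)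
    (hθ : HasDerivWithinAt θ θ' I t) :
    HasDerivWithinAt (perturb γ θ a) (perturbVelocity (γ t) (θ t) a v θ') I t :=
  have h1 : HasDerivWithinAt (fun u => (γ u).1) v.1 I t := hγ.fst
  have h2 : HasDerivWithinAt (fun u => (γ u).2) v.2 I t := hγ.snd
  (hasDerivWithinAt_mul_exp a.1 h1 hθ).prodMk (hasDerivWithinAt_mul_exp a.2 h2 hθ)

/-- The squared speed of a perturbed curve. -/
theorem gM_perturb {v : Mat p × Mat p} {t : ℝ} (θ' : ℝ) (hM : γ t ∈ M p) :
    gM k (perturb γ θ a t) (perturbVelocity (γ t) (θ t) a v θ')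
        (perturbVelocity (γ t) (θ t) a v θ') =
      lieForm k (leftLog (γ t) v) (leftLog (γ t) v) +
        2 * θ' * lieForm k (leftLog (γ t) v) a + θ' ^ 2 * lieForm k a a := by
  rw [gM_self]
  simp only [lieForm, leftLog, perturb, perturbVelocity]
  rw [leftLog_mul_exp (SO.isUnit hM.1), leftLog_mul_exp (DiagPos.isUnit hM.2),
    trace_sq_conj_add _ (exp_mul_inv _) (commute_exp_smul _ _),
    trace_sq_conj_add _ (exp_mul_inv _) (commute_exp_smul _ _)]
  ring

end Exponential

end ScalingRotation

/-! ### First variation of length -/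

namespace ScalingRotation

variable {p : ℕ} {k : ℝ}

section Calculus

theorem sq_integral_sqrt_le {h : ℝ → ℝ} (hc : ContinuousOn h (Icc 0 1))
    (h0 : ∀ t ∈ Icc (0 : ℝ) 1, 0 ≤ h t) :
    (∫ t in (0 : ℝ)..1, Real.sqrt (h t)) ^ 2 ≤ ∫ t in (0 : ℝ)..1, h t := by
  set m := ∫ t in (0 : ℝ)..1, Real.sqrt (h t) with hm
  have hi : IntervalIntegrable h MeasureTheory.volume 0 1 :=
    hc.intervalIntegrable_of_Icc zero_le_one
  have hsi : IntervalIntegrable (fun t => Real.sqrt (h t)) MeasureTheory.volume 0 1 :=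
    (Real.continuous_sqrt.comp_continuousOn hc).intervalIntegrable_of_Icc zero_le_one
  have h1 : 0 ≤ ∫ t in (0 : ℝ)..1, (Real.sqrt (h t) - m) ^ 2 :=
    intervalIntegral.integral_nonneg zero_le_one fun _ _ => sq_nonneg _
  have h2 : ∫ t in (0 : ℝ)..1, (Real.sqrt (h t) - m) ^ 2 =
      ∫ t in (0 : ℝ)..1, (h t - 2 * m * Real.sqrt (h t) + m ^ 2) := by
    refine intervalIntegral.integral_congr fun t ht => ?_
    rw [uIcc_of_le zero_le_one] at ht
    rw [sub_sq, Real.sq_sqrt (h0 t ht)]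
    ring
  rw [h2, intervalIntegral.integral_add (hi.sub (hsi.const_mul _)) (by simp),
    intervalIntegral.integral_sub hi (hsi.const_mul _), intervalIntegral.integral_const_mul,
    ← hm] at h1
  simp only [intervalIntegral.integral_const, sub_zero, smul_eq_mul, one_mul] at h1
  nlinarith

theorem hasDerivWithinAt_integral {f : ℝ → ℝ} {a b t : ℝ} (hf : ContinuousOn f (Icc a b))
    (ht : t ∈ Icc a b) : HasDerivWithinAt (fun u => ∫ s in a..u, f s) (f t) (Icc a b) t := by
  have hab : a ≤ b := ht.1.trans ht.2
  have hc : Continuous (IccExtend hab ((Icc a b).domRestrict f)) :=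
    (continuousOn_iff_continuous_domRestrict.1 hf).Icc_extend'
  have h1 := intervalIntegral.integral_hasDerivAt_right (hc.intervalIntegrable a t)
    (hc.stronglyMeasurableAtFilter _ _) hc.continuousAt
  have he : ∀ s ∈ Icc a b, IccExtend hab ((Icc a b).domRestrict f) s = f s := fun s hs => by
    rw [IccExtend_of_mem _ _ hs, domRestrict_apply]
  rw [he t ht] at h1
  refine h1.hasDerivWithinAt.congr_of_mem (fun u hu => ?_) ht
  refine intervalIntegral.integral_congr fun s hs => (he s ?_).symm
  rw [uIcc_of_le hu.1] at hs
  exact ⟨hs.1, hs.2.trans hu.2⟩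

theorem contDiffOn_of_hasDerivWithinAt {θ f : ℝ → ℝ} {a b : ℝ} (hab : a < b)
    (hθ : ∀ t ∈ Icc a b, HasDerivWithinAt θ (f t) (Icc a b) t)
    (hf : ContDiffOn ℝ ∞ f (Icc a b)) : ContDiffOn ℝ ∞ θ (Icc a b) := by
  rw [contDiffOn_infty_iff_derivWithin (uniqueDiffOn_Icc hab)]
  refine ⟨fun t ht => (hθ t ht).differentiableWithinAt, hf.congr fun t ht => ?_⟩
  exact (hθ t ht).derivWithin (uniqueDiffOn_Icc hab t ht)

theorem eq_zero_of_forall_quadratic_nonneg {A B : ℝ} (h : ∀ s : ℝ, 0 ≤ 2 * s * A + s ^ 2 * B) :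
    A = 0 := by
  have hB : 0 ≤ B := by linarith [h 1, h (-1)]
  have h1 := h (-A / (B + 1))
  have h2 : 2 * (-A / (B + 1)) * A + (-A / (B + 1)) ^ 2 * B =
      -(A ^ 2 * (B + 2)) / (B + 1) ^ 2 := by
    field_simp
    ring
  rw [h2, div_nonneg_iff] at h1
  have h3 : (0 : ℝ) < (B + 1) ^ 2 := by positivity
  rcases h1 with ⟨h1, -⟩ | ⟨-, h1⟩
  · have : A ^ 2 * (B + 2) ≤ 0 := by linarith
    have h4 : 0 ≤ A ^ 2 * B := by positivity
    have : A ^ 2 ≤ 0 := by linarith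
    exact pow_eq_zero_iff two_ne_zero |>.1 (le_antisymm this (sq_nonneg A))
  · linarith

end Calculus

section Variation

variable {γ : ℝ → Mat p × Mat p} {a : Mat p × Mat p} {c : ℝ}

/-- The velocity of a curve in `M(p)` over `[0, 1]`, translated to the identity. -/
noncomputable def velocity (γ : ℝ → Mat p × Mat p) (t : ℝ) : Mat p × Mat p :=
  leftLog (γ t) (derivWithin γ (Icc 0 1) t)

theorem hasDerivWithinAt_Icc (hγ : ContDiffOn ℝ ∞ γ (Icc 0 1)) {t : ℝ} (ht : t ∈ Icc (0 : ℝ) 1) :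
    HasDerivWithinAt γ (derivWithin γ (Icc 0 1) t) (Icc 0 1) t :=
  (hγ.differentiableOn (by simp) t ht).hasDerivWithinAt

theorem velocity_mem (hγ : ContDiffOn ℝ ∞ γ (Icc 0 1)) (hM : MapsTo γ (Icc 0 1) (M p)) {t : ℝ}
    (ht : t ∈ Icc (0 : ℝ) 1) : velocity γ t ∈ lieAlg p :=
  leftLog_mem_lieAlg (uniqueDiffOn_Icc zero_lt_one t ht) ht hM (hasDerivWithinAt_Icc hγ ht)

theorem contDiffOn_velocity (hγ : ContDiffOn ℝ ∞ γ (Icc 0 1)) (hM : MapsTo γ (Icc 0 1) (M p)) :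
    ContDiffOn ℝ ∞ (velocity γ) (Icc 0 1) := by
  have hd : ContDiffOn ℝ ∞ (derivWithin γ (Icc 0 1)) (Icc 0 1) :=
    ((contDiffOn_infty_iff_derivWithin (uniqueDiffOn_Icc zero_lt_one)).1 hγ).2
  have h1 : ContDiffOn ℝ ∞ (fun t => (γ t).1⁻¹) (Icc 0 1) :=
    contDiffOn_inv.comp hγ.fst fun _ ht => SO.isUnit (hM ht).1
  have h2 : ContDiffOn ℝ ∞ (fun t => (γ t).2⁻¹) (Icc 0 1) :=
    contDiffOn_inv.comp hγ.snd fun _ ht => DiagPos.isUnit (hM ht).2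
  exact (h1.mul hd.fst).prodMk (h2.mul hd.snd)

theorem contDiff_lieForm (a : Mat p × Mat p) : ContDiff ℝ ∞ fun b => lieForm k b a := by
  unfold lieForm
  exact (contDiff_const.mul (contDiff_trace.comp (contDiff_fst.mul contDiff_const))).add
    (contDiff_trace.comp (contDiff_snd.mul contDiff_const))

theorem curveLength_perturb {θ θ' : ℝ → ℝ} (hγ : ContDiffOn ℝ ∞ γ (Icc 0 1))
    (hM : MapsTo γ (Icc 0 1) (M p))
    (hθ : ∀ t ∈ Icc (0 : ℝ) 1, HasDerivWithinAt θ (θ' t) (Icc 0 1) t) :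
    curveLength (gM k) (perturb γ θ a) 0 1 = ∫ t in (0 : ℝ)..1,
      Real.sqrt (lieForm k (velocity γ t) (velocity γ t) + 2 * θ' t * lieForm k (velocity γ t) a +
        θ' t ^ 2 * lieForm k a a) :=
  curveLength_eq_integral zero_le_one
    (fun t ht => hasDerivWithinAt_perturb (hasDerivWithinAt_Icc hγ (Ioo_subset_Icc_self ht))
      (hθ t (Ioo_subset_Icc_self ht)))
    (fun _ ht => gM_perturb _ (hM (Ioo_subset_Icc_self ht)))

/-- The first variation formula for a constant-speed curve that is shorter than the curves obtained
by perturbing it. As the squared speed of a perturbation is an exact quadratic polynomial, the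
Cauchy-Schwarz comparison of length and energy reduces it to an elementary inequality. -/
theorem integral_mul_lieForm_eq_zero (hk : 0 ≤ k) {θ θ' : ℝ → ℝ}
    (hγ : ContDiffOn ℝ ∞ γ (Icc 0 1)) (hM : MapsTo γ (Icc 0 1) (M p)) (ha : a ∈ lieAlg p)
    (hc : ∀ t ∈ Icc (0 : ℝ) 1, lieForm k (velocity γ t) (velocity γ t) = c ^ 2)
    (hL : curveLength (gM k) γ 0 1 = c) (hc0 : 0 ≤ c)
    (hθ : ∀ t ∈ Icc (0 : ℝ) 1, HasDerivWithinAt θ (θ' t) (Icc 0 1) t)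
    (hθ' : ContinuousOn θ' (Icc 0 1))
    (hmin : ∀ s : ℝ, curveLength (gM k) γ 0 1 ≤
      curveLength (gM k) (perturb γ (fun t => s * θ t) a) 0 1) :
    ∫ t in (0 : ℝ)..1, θ' t * lieForm k (velocity γ t) a = 0 := by
  have hf : ContinuousOn (fun t => lieForm k (velocity γ t) a) (Icc 0 1) :=
    (continuous_lieForm k a).comp_continuousOn (contDiffOn_velocity hγ hM).continuousOn
  refine eq_zero_of_forall_quadratic_nonneg
    (B := (∫ t in (0 : ℝ)..1, θ' t ^ 2) * lieForm k a a) fun s => ?_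
  have h1 := hmin s
  rw [curveLength_perturb hγ hM (fun t ht => (hθ t ht).const_mul s), hL] at h1
  have hQ : ∀ t ∈ Icc (0 : ℝ) 1, 0 ≤ lieForm k (velocity γ t) (velocity γ t) +
      2 * (s * θ' t) * lieForm k (velocity γ t) a + (s * θ' t) ^ 2 * lieForm k a a := by
    intro t ht
    have hv := velocity_mem hγ hM ht
    have := lieForm_self_nonneg hk (lieAlg.sub_mem hv (lieAlg.smul_mem (-(s * θ' t)) ha))
    refine this.trans_eq ?_
    simp only [lieForm, Prod.fst_sub, Prod.snd_sub, Prod.smul_fst, Prod.smul_snd, sub_mul, mul_sub,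
      smul_mul_assoc, mul_smul_comm, Matrix.trace_sub, Matrix.trace_smul, smul_eq_mul]
    rw [Matrix.trace_mul_comm a.1, Matrix.trace_mul_comm a.2]
    ring
  have hcQ : ∀ t ∈ Icc (0 : ℝ) 1, lieForm k (velocity γ t) (velocity γ t) +
      2 * (s * θ' t) * lieForm k (velocity γ t) a + (s * θ' t) ^ 2 * lieForm k a a =
      c ^ 2 + 2 * s * (θ' t * lieForm k (velocity γ t) a) +
        s ^ 2 * lieForm k a a * θ' t ^ 2 := by
    intro t ht
    rw [hc t ht]
    ring
  have hi1 : ContinuousOn (fun t => θ' t * lieForm k (velocity γ t) a) (Icc 0 1) := hθ'.mul hf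
  have hi2 : ContinuousOn (fun t => θ' t ^ 2) (Icc 0 1) := hθ'.pow 2
  have hcont : ContinuousOn (fun t => c ^ 2 + 2 * s * (θ' t * lieForm k (velocity γ t) a) +
        s ^ 2 * lieForm k a a * θ' t ^ 2) (Icc 0 1) :=
    (continuousOn_const.add (continuousOn_const.mul hi1)).add (continuousOn_const.mul hi2)
  have h2 := sq_integral_sqrt_le (hcont.congr hcQ) hQ
  have h3 : ∫ t in (0 : ℝ)..1, (lieForm k (velocity γ t) (velocity γ t) +
      2 * (s * θ' t) * lieForm k (velocity γ t) a + (s * θ' t) ^ 2 * lieForm k a a) =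
      c ^ 2 + 2 * s * (∫ t in (0 : ℝ)..1, θ' t * lieForm k (velocity γ t) a) +
        s ^ 2 * lieForm k a a * ∫ t in (0 : ℝ)..1, θ' t ^ 2 := by
    have j1 := hi1.intervalIntegrable_of_Icc (μ := MeasureTheory.volume) zero_le_one
    have j2 := hi2.intervalIntegrable_of_Icc (μ := MeasureTheory.volume) zero_le_one
    rw [intervalIntegral.integral_congr (g := fun t => c ^ 2 +
        2 * s * (θ' t * lieForm k (velocity γ t) a) + s ^ 2 * lieForm k a a * θ' t ^ 2)
        (fun t ht => hcQ t (by rwa [uIcc_of_le zero_le_one] at ht)),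
      intervalIntegral.integral_add ((by simp : IntervalIntegrable _ _ _ _).add (j1.const_mul _))
        (j2.const_mul _),
      intervalIntegral.integral_add (by simp) (j1.const_mul _),
      intervalIntegral.integral_const_mul, intervalIntegral.integral_const_mul]
    simp
  rw [h3] at h2
  have h4 := pow_le_pow_left₀ hc0 h1 2
  linarith

/-- The curve `t ↦ q · exp (t a)` in `M(p)`. -/
noncomputable def expCurve (q a : Mat p × Mat p) (t : ℝ) : Mat p × Mat p :=
  (q.1 * exp (t • a.1), q.2 * exp (t • a.2))

theorem mul_exp_eq_of_hasDerivWithinAt {P : ℝ → Mat p} {A : Mat p}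
    (h : ∀ t ∈ Icc (0 : ℝ) 1, HasDerivWithinAt P (P t * A) (Icc 0 1) t) {t : ℝ}
    (ht : t ∈ Icc (0 : ℝ) 1) : P t = P 0 * exp (t • A) := by
  have h1 : ∀ u ∈ Icc (0 : ℝ) 1,
      HasDerivWithinAt (fun u => P u * exp (u • -A)) 0 (Icc 0 1) u := by
    intro u hu
    refine ((h u hu).mul (hasDerivAt_exp_smul (-A) u).hasDerivWithinAt).congr_deriv ?_
    rw [(commute_exp_smul (-A) u).eq]
    noncomm_ring
  have h2 : P t * exp (t • -A) = P 0 * exp ((0 : ℝ) • -A) := by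
    refine constant_of_derivWithin_zero (f := fun u => P u * exp (u • -A))
      (fun u hu => (h1 u hu).differentiableWithinAt) (fun u hu => ?_) t ht
    have hu' := Ico_subset_Icc_self hu
    exact (h1 u hu').derivWithin (uniqueDiffOn_Icc zero_lt_one u hu')
  rw [zero_smul, NormedSpace.exp_zero, mul_one, smul_neg, Matrix.exp_neg] at h2
  rw [← h2, mul_assoc, exp_inv_mul, mul_one]

/-- A constant-speed curve that is shortest among the curves in `M(p)` with the same endpoints is a
translate of a one-parameter subgroup. -/
theorem exists_eq_expCurve_of_minimal (hk : 0 < k)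
    (hγ : ContDiffOn ℝ ∞ γ (Icc 0 1)) (hM : MapsTo γ (Icc 0 1) (M p))
    (hc : ∀ t ∈ Icc (0 : ℝ) 1, lieForm k (velocity γ t) (velocity γ t) = c ^ 2)
    (hL : curveLength (gM k) γ 0 1 = c) (hc0 : 0 ≤ c)
    (hmin : ∀ η, IsPiecewiseSmoothIn (M p) η → η 0 = γ 0 → η 1 = γ 1 →
      curveLength (gM k) γ 0 1 ≤ curveLength (gM k) η 0 1) :
    ∃ a ∈ lieAlg p, (∀ t ∈ Icc (0 : ℝ) 1, velocity γ t = a) ∧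
      ∀ t ∈ Icc (0 : ℝ) 1, γ t = expCurve (γ 0) a t := by
  have h0 : (0 : ℝ) ∈ Icc (0 : ℝ) 1 := left_mem_Icc.2 zero_le_one
  -- Each component of the velocity is constant, by the first variation formula with the profile
  -- whose derivative is the deviation of the component from its mean.
  have key : ∀ b ∈ lieAlg p, ∃ m, ∀ t ∈ Icc (0 : ℝ) 1, lieForm k (velocity γ t) b = m := by
    intro b hb
    set f : ℝ → ℝ := fun t => lieForm k (velocity γ t) b with hf
    have hfs : ContDiffOn ℝ ∞ f (Icc 0 1) :=
      (contDiff_lieForm b).comp_contDiffOn (contDiffOn_velocity hγ hM)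
    set m := ∫ t in (0 : ℝ)..1, f t with hm
    have hfm : ContDiffOn ℝ ∞ (fun t => f t - m) (Icc 0 1) := hfs.sub contDiffOn_const
    set θ : ℝ → ℝ := fun u => ∫ s in (0 : ℝ)..u, (f s - m) with hθ
    have hθd : ∀ t ∈ Icc (0 : ℝ) 1, HasDerivWithinAt θ (f t - m) (Icc 0 1) t :=
      fun t ht => hasDerivWithinAt_integral hfm.continuousOn ht
    have hfi := hfs.continuousOn.intervalIntegrable_of_Icc (μ := MeasureTheory.volume) zero_le_one
    have hfmi := hfm.continuousOn.intervalIntegrable_of_Icc (μ := MeasureTheory.volume) zero_le_one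
    have hθ0 : θ 0 = 0 := intervalIntegral.integral_same
    have hθ1 : θ 1 = 0 := by
      simp only [hθ]
      rw [intervalIntegral.integral_sub hfi (by simp), ← hm]
      simp
    have hvar : ∫ t in (0 : ℝ)..1, (f t - m) * f t = 0 := by
      refine integral_mul_lieForm_eq_zero hk.le hγ hM hb hc hL hc0 hθd hfm.continuousOn fun s => ?_
      refine hmin _ (isPiecewiseSmoothIn_of_contDiffOn (contDiffOn_perturb hγ
        (contDiffOn_const.mul (contDiffOn_of_hasDerivWithinAt zero_lt_one hθd hfm)))
        (mapsTo_perturb hM hb)) ?_ ?_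
      · simp [perturb, hθ0]
      · simp [perturb, hθ1]
    have hsq : ∫ t in (0 : ℝ)..1, (f t - m) ^ 2 = 0 := by
      have e : ∀ t, (f t - m) ^ 2 = (f t - m) * f t - m * (f t - m) := fun t => by ring
      simp only [e]
      have hi : IntervalIntegrable (fun t => (f t - m) * f t) MeasureTheory.volume 0 1 :=
        (hfm.continuousOn.mul hfs.continuousOn).intervalIntegrable_of_Icc zero_le_one
      rw [intervalIntegral.integral_sub hi
          (hfmi.const_mul m), hvar, intervalIntegral.integral_const_mul]
      have : ∫ t in (0 : ℝ)..1, (f t - m) = 0 := hθ1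
      rw [this]
      simp
    refine ⟨m, fun t ht => ?_⟩
    by_contra hne
    have hpos : 0 < ∫ t in (0 : ℝ)..1, (f t - m) ^ 2 := by
      refine intervalIntegral.integral_pos zero_lt_one (hfm.continuousOn.pow 2)
        (fun _ _ => sq_nonneg _) ⟨t, ht, ?_⟩
      exact sq_pos_of_ne_zero (sub_ne_zero.2 hne)
    exact hpos.ne' hsq
  have hconst : ∀ t ∈ Icc (0 : ℝ) 1, velocity γ t = velocity γ 0 := by
    intro t ht
    have hm := lieAlg.sub_mem (velocity_mem hγ hM ht) (velocity_mem hγ hM h0)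
    obtain ⟨m, hm'⟩ := key _ hm
    refine sub_eq_zero.1 (eq_zero_of_lieForm_self_eq_zero hk hm ?_)
    rw [lieForm_sub_left, hm' t ht, hm' 0 h0, sub_self]
  refine ⟨velocity γ 0, velocity_mem hγ hM h0, hconst, fun t ht => ?_⟩
  have hd : ∀ u ∈ Icc (0 : ℝ) 1, derivWithin γ (Icc 0 1) u =
      ((γ u).1 * (velocity γ 0).1, (γ u).2 * (velocity γ 0).2) := by
    intro u hu
    rw [← hconst u hu]
    have e1 : (γ u).1 * (γ u).1⁻¹ = 1 :=
      Matrix.mul_nonsing_inv _ ((Matrix.isUnit_iff_isUnit_det _).1 (SO.isUnit (hM hu).1))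
    have e2 : (γ u).2 * (γ u).2⁻¹ = 1 :=
      Matrix.mul_nonsing_inv _ ((Matrix.isUnit_iff_isUnit_det _).1 (DiagPos.isUnit (hM hu).2))
    refine Prod.ext ?_ ?_
    · simp only [velocity, leftLog]
      rw [← mul_assoc, e1, one_mul]
    · simp only [velocity, leftLog]
      rw [← mul_assoc, e2, one_mul]
  have hγd : ∀ u ∈ Icc (0 : ℝ) 1, HasDerivWithinAt γ
      ((γ u).1 * (velocity γ 0).1, (γ u).2 * (velocity γ 0).2) (Icc 0 1) u := by
    intro u hu
    rw [← hd u hu]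
    exact hasDerivWithinAt_Icc hγ hu
  exact Prod.ext
    (mul_exp_eq_of_hasDerivWithinAt (P := fun u => (γ u).1) (fun u hu => (hγd u hu).fst) ht)
    (mul_exp_eq_of_hasDerivWithinAt (P := fun u => (γ u).2) (fun u hu => (hγd u hu).snd) ht)

end Variation

end ScalingRotation

/-! ### Identity components of block orthogonal groups -/

namespace ScalingRotation

variable {p : ℕ} {k : ℝ}

section Blocks

variable {ι : Type*} {κ : Fin p → ι}

/-- The orthogonal matrices that preserve the decomposition of the coordinates into the level
sets of `κ`. -/
def blockOrthogonal (κ : Fin p → ι) : Set (Mat p) :=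
  {N | N * Nᵀ = 1 ∧ ∀ i j, κ i ≠ κ j → N i j = 0}

theorem blockOrthogonal.mul_mem {N N' : Mat p} (h : N ∈ blockOrthogonal κ)
    (h' : N' ∈ blockOrthogonal κ) : N * N' ∈ blockOrthogonal κ := by
  refine ⟨?_, fun i j hij => ?_⟩
  · rw [Matrix.transpose_mul, mul_assoc, ← mul_assoc N', h'.1, one_mul, h.1]
  · rw [Matrix.mul_apply]
    refine Finset.sum_eq_zero fun l _ => ?_
    by_cases hil : κ i = κ l
    · rw [h'.2 l j (hil ▸ hij), mul_zero]
    · rw [h.2 i l hil, zero_mul]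

/-- The diagonal matrix of a family of signs. -/
def signMat (s : Fin p → ℤˣ) : Mat p := Matrix.diagonal fun i => ((s i : ℤ) : ℝ)

theorem signMat_mul_self (s : Fin p → ℤˣ) : signMat s * signMat s = 1 := by
  rw [signMat, Matrix.diagonal_mul_diagonal, ← Matrix.diagonal_one]
  congr 1
  funext i
  rcases Int.units_eq_one_or (s i) with h | h <;> simp [h]

theorem signMat_mem (s : Fin p → ℤˣ) : signMat s ∈ blockOrthogonal κ := by
  refine ⟨by rw [signMat, Matrix.diagonal_transpose]; exact signMat_mul_self s, fun i j hij => ?_⟩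
  exact Matrix.diagonal_apply_ne _ fun h => hij (congrArg κ h)

theorem joinedIn_mul_right {N N' Q : Mat p} (hQ : Q ∈ blockOrthogonal κ)
    (h : JoinedIn (blockOrthogonal κ) N N') : JoinedIn (blockOrthogonal κ) (N * Q) (N' * Q) := by
  obtain ⟨γ, hγ⟩ := h
  exact ⟨γ.map (continuous_id.mul continuous_const), fun t => blockOrthogonal.mul_mem (hγ t) hQ⟩

theorem joinedIn_mul_left {N N' Q : Mat p} (hQ : Q ∈ blockOrthogonal κ)
    (h : JoinedIn (blockOrthogonal κ) N N') : JoinedIn (blockOrthogonal κ) (Q * N) (Q * N') := by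
  obtain ⟨γ, hγ⟩ := h
  exact ⟨γ.map (continuous_const.mul continuous_id), fun t => blockOrthogonal.mul_mem hQ (hγ t)⟩

/-- The Householder reflection in the hyperplane orthogonal to `w` (for `w ≠ 0`). -/
noncomputable def householder (w : Fin p → ℝ) : Mat p :=
  1 - (2 / (w ⬝ᵥ w)) • Matrix.vecMulVec w w

theorem householder_mulVec (w x : Fin p → ℝ) :
    householder w *ᵥ x = x - (2 / (w ⬝ᵥ w) * (w ⬝ᵥ x)) • w := by
  rw [householder, Matrix.sub_mulVec, Matrix.one_mulVec, Matrix.smul_mulVec,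
    Matrix.vecMulVec_mulVec, op_smul_eq_smul, smul_smul]

theorem householder_transpose (w : Fin p → ℝ) : (householder w)ᵀ = householder w := by
  simp [householder, Matrix.transpose_vecMulVec]

theorem householder_mul_self {w : Fin p → ℝ} (hw : w ≠ 0) : householder w * householder w = 1 := by
  have h : w ⬝ᵥ w ≠ 0 := fun h => hw (dotProduct_self_eq_zero.1 h)
  refine Matrix.ext_of_mulVec_single fun i => ?_
  rw [← Matrix.mulVec_mulVec, householder_mulVec, householder_mulVec, dotProduct_sub,
    dotProduct_smul, Matrix.one_mulVec]
  ext j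
  simp only [Pi.sub_apply, Pi.smul_apply, smul_eq_mul]
  field_simp
  ring

theorem householder_mem {w : Fin p → ℝ} (hw : w ≠ 0) {i₀ : Fin p}
    (h : ∀ i, κ i ≠ κ i₀ → w i = 0) : householder w ∈ blockOrthogonal κ := by
  refine ⟨by rw [householder_transpose, householder_mul_self hw], fun i j hij => ?_⟩
  have hne : i ≠ j := fun h => hij (congrArg κ h)
  have h0 : w i * w j = 0 := by
    by_cases hi : κ i = κ i₀
    · rw [h j (hi ▸ hij.symm), mul_zero]
    · rw [h i hi, zero_mul]
  simp [householder, Matrix.vecMulVec_apply, h0, hne]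

theorem householder_single (i : Fin p) {x : ℝ} (hx : x ≠ 0) :
    householder (Pi.single i x) = signMat (Function.update 1 i (-1)) := by
  ext j l
  simp only [householder, signMat, Matrix.sub_apply, Matrix.smul_apply, Matrix.vecMulVec_apply,
    Matrix.one_apply, Matrix.diagonal_apply, single_dotProduct, Pi.single_eq_same, smul_eq_mul]
  by_cases hjl : j = l
  · subst hjl
    by_cases hji : j = i
    · subst hji
      simp only [if_true, Pi.single_eq_same, Function.update_self]
      field_simp
      norm_num
    · simp [hji]
  · by_cases hji : j = i
    · subst hji
      simp [hjl, Ne.symm hjl]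
    · simp [hjl, hji]

theorem continuousOn_householder : ContinuousOn (householder (p := p)) {w | w ≠ 0} := by
  unfold householder
  have h1 : ContinuousOn (fun w : Fin p → ℝ => 2 / (w ⬝ᵥ w)) {w | w ≠ 0} :=
    continuousOn_const.div (continuous_id.dotProduct continuous_id).continuousOn
      fun w hw h => hw (dotProduct_self_eq_zero.1 h)
  have h2 : ContinuousOn (fun w : Fin p → ℝ => Matrix.vecMulVec w w) {w | w ≠ 0} :=
    (continuous_id.matrix_vecMulVec continuous_id).continuousOn
  exact continuousOn_const.sub (h1.smul h2)

/-- A block reflection can be moved to a reflection in a coordinate hyperplane. -/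
theorem exists_joinedIn_householder {w : Fin p → ℝ} (hw : w ≠ 0) {i₀ : Fin p}
    (h : ∀ i, κ i ≠ κ i₀ → w i = 0) :
    ∃ s, JoinedIn (blockOrthogonal κ) (householder w) (signMat s) := by
  obtain ⟨i, hi⟩ := Function.ne_iff.1 hw
  -- The coordinate `i` of `w` stays unchanged along the segment, which therefore avoids `0`.
  set f : ℝ → Fin p → ℝ := fun t => (1 - t) • w + t • Pi.single i (w i) with hf
  have hfi : ∀ t, f t ≠ 0 := fun t h0 => hi <| by
    have := congrFun h0 i
    simp only [hf, Pi.add_apply, Pi.smul_apply, Pi.single_eq_same, smul_eq_mul, Pi.zero_apply]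
      at this
    rw [Pi.zero_apply]
    linarith
  have hii : κ i = κ i₀ := by
    by_contra hne
    exact hi (h i hne)
  have hfs : ∀ t j, κ j ≠ κ i₀ → f t j = 0 := fun t j hj => by
    have hji : j ≠ i := fun e => hj (e ▸ hii)
    simp [hf, h j hj, hji]
  have hc : Continuous fun t => householder (f t) :=
    continuousOn_householder.comp_continuous (by fun_prop) hfi
  refine ⟨Function.update 1 i (-1), ?_⟩
  refine JoinedIn.ofLine hc.continuousOn (by simp [hf]) ?_ ?_
  · simp only [hf, sub_self, zero_smul, zero_add, one_smul]
    exact householder_single i hi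
  · rintro _ ⟨t, -, rfl⟩
    exact householder_mem (hfi t) (hfs t)

theorem mulVec_dotProduct_mulVec {N : Mat p} (hN : N * Nᵀ = 1) (x y : Fin p → ℝ) :
    N *ᵥ x ⬝ᵥ N *ᵥ y = x ⬝ᵥ y := by
  rw [Matrix.dotProduct_mulVec, Matrix.vecMul_mulVec, ← Matrix.dotProduct_mulVec,
    mul_eq_one_comm.1 hN, Matrix.one_mulVec]

/-- Every block orthogonal matrix can be joined to a diagonal matrix of signs. It is a product of
block reflections: multiplying by the reflection that takes `N eᵢ` to `eᵢ` makes `eᵢ` a fixed vector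
and preserves the other fixed coordinate vectors. -/
theorem exists_joinedIn_signMat (N : Mat p) (hN : N ∈ blockOrthogonal κ) :
    ∃ s, JoinedIn (blockOrthogonal κ) N (signMat s) := by
  classical
  induction hn : (Finset.univ.filter fun i : Fin p =>
    N *ᵥ Pi.single i 1 ≠ Pi.single i 1).card using Nat.strong_induction_on generalizing N with
  | _ n ih =>
  by_cases hfix : ∀ i : Fin p, N *ᵥ Pi.single i 1 = Pi.single i 1
  · have h1 : N = signMat 1 := by
      refine Matrix.ext_of_mulVec_single fun i => ?_
      rw [hfix i]
      ext j
      simp [signMat, Matrix.one_apply, Pi.single_apply]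
    exact ⟨1, h1 ▸ JoinedIn.refl hN⟩
  · push Not at hfix
    obtain ⟨i, hi⟩ := hfix
    set w : Fin p → ℝ := N *ᵥ Pi.single i 1 - Pi.single i 1 with hw
    have hw0 : w ≠ 0 := sub_ne_zero.2 hi
    have hww : w ⬝ᵥ w ≠ 0 := fun h => hw0 (dotProduct_self_eq_zero.1 h)
    have hws : ∀ j, κ j ≠ κ i → w j = 0 := fun j hj => by
      have hji : j ≠ i := fun e => hj (e ▸ rfl)
      simp [hw, hN.2 j i hj, hji]
    have hNi := mulVec_dotProduct_mulVec hN.1 (Pi.single i 1) (Pi.single i 1)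
    have hH := householder_mem hw0 hws
    have hMi : (householder w * N) *ᵥ Pi.single i 1 = Pi.single i 1 := by
      rw [← Matrix.mulVec_mulVec, householder_mulVec]
      have e : 2 / (w ⬝ᵥ w) * (w ⬝ᵥ N *ᵥ Pi.single i 1) = 1 := by
        rw [div_mul_eq_mul_div, div_eq_one_iff_eq hww, hw]
        simp only [sub_dotProduct, dotProduct_sub, hNi]
        rw [dotProduct_comm (N *ᵥ Pi.single i 1) (Pi.single i 1)]
        ring
      rw [e, one_smul, hw, sub_sub_cancel]
    have hMj : ∀ j, N *ᵥ Pi.single j 1 = Pi.single j 1 →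
        (householder w * N) *ᵥ Pi.single j 1 = Pi.single j 1 := by
      intro j hj
      rw [← Matrix.mulVec_mulVec, householder_mulVec, hj]
      have e : w ⬝ᵥ Pi.single j 1 = 0 := by
        rw [hw, sub_dotProduct]
        nth_rewrite 1 [← hj]
        rw [mulVec_dotProduct_mulVec hN.1, sub_self]
      rw [e, mul_zero, zero_smul, sub_zero]
    have hlt : (Finset.univ.filter fun j : Fin p =>
        (householder w * N) *ᵥ Pi.single j 1 ≠ Pi.single j 1).card < n := by
      rw [← hn]
      refine Finset.card_lt_card (Finset.ssubset_iff_of_subset ?_ |>.2 ⟨i, by simpa using hi, ?_⟩)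
      · intro j hj
        rw [Finset.mem_filter] at hj ⊢
        exact ⟨hj.1, fun h => hj.2 (hMj j h)⟩
      · rw [Finset.mem_filter]
        exact fun h => h.2 hMi
    obtain ⟨s, hs⟩ := ih _ hlt _ (blockOrthogonal.mul_mem hH hN) rfl
    obtain ⟨s', hs'⟩ := exists_joinedIn_householder hw0 hws
    refine ⟨s' * s, ?_⟩
    have h1 := joinedIn_mul_right (blockOrthogonal.mul_mem hH hN) hs'
    rw [← mul_assoc, householder_mul_self hw0, one_mul] at h1
    have h2 := joinedIn_mul_left (signMat_mem s') hs
    have h3 : signMat s' * signMat s = signMat (s' * s) := by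
      simp [signMat, Matrix.diagonal_mul_diagonal]
    rw [h3] at h2
    exact h1.trans h2

theorem det_eq_one_or_neg_one {N : Mat p} (h : N * Nᵀ = 1) : N.det = 1 ∨ N.det = -1 := by
  have := congrArg Matrix.det h
  rw [Matrix.det_mul, Matrix.det_transpose, Matrix.det_one] at this
  exact mul_self_eq_one_iff.1 this

/-- Up to signs, a block orthogonal matrix lies in the identity component of the block special
orthogonal group. -/
theorem exists_mul_signMat_mem_component {N : Mat p} (hN : N ∈ blockOrthogonal κ) :
    ∃ s, N * signMat s ∈ connectedComponentIn (SO p ∩ blockOrthogonal κ) 1 := by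
  obtain ⟨s, hs⟩ := exists_joinedIn_signMat N hN
  have h1 := joinedIn_mul_right (signMat_mem s) hs
  rw [signMat_mul_self] at h1
  obtain ⟨γ, hγ⟩ := h1
  have hpre : IsPreconnected (range γ) := isPreconnected_range γ.continuous
  have hdet : ∀ t, (γ t).det = 1 := by
    intro t
    have hc : ContinuousOn (fun A : Mat p => A.det) (range γ) :=
      (Continuous.matrix_det continuous_id).continuousOn
    have hm : MapsTo (fun A : Mat p => A.det) (range γ) ({1, -1} : Set ℝ) := by
      rintro _ ⟨t, rfl⟩
      exact det_eq_one_or_neg_one (hγ t).1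
    have := hpre.constant_of_mapsTo (Set.toFinite _).isDiscrete hc hm (mem_range_self t) (mem_range_self 1)
    simpa using this
  refine ⟨s, hpre.subset_connectedComponentIn ⟨1, γ.target⟩ ?_ ⟨0, γ.source⟩⟩
  rintro _ ⟨t, rfl⟩
  exact ⟨mem_SO_iff.2 ⟨(hγ t).1, hdet t⟩, hγ t⟩

theorem mul_diagonal_eq_iff {N : Mat p} {d d' : Fin p → ℝ} :
    N * Matrix.diagonal d = Matrix.diagonal d' * N ↔ ∀ i j, d' i ≠ d j → N i j = 0 := by
  rw [← Matrix.ext_iff]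
  refine forall_congr' fun i => forall_congr' fun j => ?_
  rw [Matrix.mul_diagonal, Matrix.diagonal_mul]
  constructor
  · intro h hne
    have : (d' i - d j) * N i j = 0 := by linarith
    exact (mul_eq_zero.1 this).resolve_left (sub_ne_zero.2 hne)
  · intro h
    by_cases e : d' i = d j
    · rw [e, mul_comm]
    · rw [h e, mul_zero, zero_mul]

theorem mem_stab_iff {R D : Mat p} : R ∈ stab D ↔ R ∈ SO p ∧ R * D = D * R := by
  refine and_congr_right fun hR => ⟨fun h => ?_, fun h => ?_⟩
  · nth_rewrite 2 [← h]
    rw [mul_assoc (R * D), SO.transpose_mul hR, mul_one]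
  · rw [h, mul_assoc, SO.mul_transpose hR, mul_one]

theorem stab_inter_stab_diagonal (d l : Fin p → ℝ) :
    stab (Matrix.diagonal d) ∩ stab (Matrix.diagonal l) =
      SO p ∩ blockOrthogonal fun i => (d i, l i) := by
  ext R
  rw [mem_inter_iff, mem_stab_iff, mem_stab_iff, mul_diagonal_eq_iff, mul_diagonal_eq_iff]
  constructor
  · rintro ⟨⟨hR, h1⟩, -, h2⟩
    refine ⟨hR, SO.mul_transpose hR, fun i j hij => ?_⟩
    by_cases hd : d i = d j
    · exact h2 i j fun hl => hij (Prod.ext hd hl)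
    · exact h1 i j hd
  · rintro ⟨hR, -, h⟩
    exact ⟨⟨hR, fun i j hij => h i j fun e => hij (congrArg Prod.fst e)⟩, hR,
      fun i j hij => h i j fun e => hij (congrArg Prod.snd e)⟩

end Blocks

end ScalingRotation

/-! ### Geodesics of minimal smooth scaling-rotation curves -/

namespace ScalingRotation

variable {p : ℕ} {k : ℝ}

section Minimal

variable {X Y : Mat p} {q r a : Mat p × Mat p} {γ : ℝ → Mat p × Mat p} {χ : ℝ → Mat p}

theorem dSR_le_curveLength {η : ℝ → Mat p × Mat p} (hη : IsPiecewiseSmoothIn (M p) η)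
    (h0 : η 0 ∈ fiber X) (h1 : η 1 ∈ fiber Y) : dSR k X Y ≤ curveLength (gM k) η 0 1 := by
  refine le_trans (csInf_le ⟨0, ?_⟩ ⟨η 0, h0, η 1, h1, rfl⟩) (geodesicDist_le_curveLength hη)
  rintro _ ⟨q, -, r, -, rfl⟩
  exact geodesicDist_nonneg _ _

theorem mul_exp_mem_fiber {B : Mat p} (hB : Bᵀ = -B) (hr : r ∈ fiber Y) (hc : Commute B r.2) :
    (r.1 * exp B, r.2) ∈ fiber Y := by
  obtain ⟨hM, rfl⟩ := hr
  have hE := exp_skew_mem hB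
  refine ⟨⟨SO.mul_mem hM.1 hE, hM.2⟩, ?_⟩
  have h1 : exp B * r.2 = r.2 * exp B := hc.exp_left.eq
  have h2 := SO.mul_transpose hE
  simp only [F, Matrix.transpose_mul]
  calc r.1 * exp B * r.2 * ((exp B)ᵀ * r.1ᵀ)
      = r.1 * (exp B * r.2) * (exp B)ᵀ * r.1ᵀ := by noncomm_ring
    _ = r.1 * r.2 * (exp B * (exp B)ᵀ) * r.1ᵀ := by rw [h1]; noncomm_ring
    _ = r.1 * r.2 * r.1ᵀ := by rw [h2, mul_one]

/-- The geodesic of an MSSR curve is `t ↦ q · exp (t a)`, and its rotational velocity `a.1` is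
orthogonal to the Lie algebra of the stabilizer of the diagonal part of its endpoint. -/
theorem IsMSSRCurve.exists_eq_expCurve (hk : 0 < k) (h : IsMSSRCurve k X Y q r γ χ) :
    ∃ a ∈ lieAlg p, (∀ t ∈ Icc (0 : ℝ) 1, γ t = expCurve q a t) ∧
      (derivWithin γ (Icc 0 1) 0).1 = q.1 * a.1 ∧
      curveLength (gM k) γ 0 1 = Real.sqrt (lieForm k a a) ∧
      ∀ B : Mat p, Bᵀ = -B → Commute B r.2 → (a.1 * B).trace = 0 := by
  have h0 : (0 : ℝ) ∈ Icc (0 : ℝ) 1 := left_mem_Icc.2 zero_le_one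
  have hγ := h.isGeodesic.smooth
  have hM := h.isGeodesic.mapsTo
  obtain ⟨c, hc⟩ := h.isGeodesic.constSpeed
  have hspeed : ∀ t ∈ Icc (0 : ℝ) 1,
      Real.sqrt (lieForm k (velocity γ t) (velocity γ t)) = c := by
    intro t ht
    rw [← hc t ht, gM_self]
    rfl
  have hc0 : 0 ≤ c := by
    rw [← hspeed 0 h0]
    exact Real.sqrt_nonneg _
  have hc2 : ∀ t ∈ Icc (0 : ℝ) 1, lieForm k (velocity γ t) (velocity γ t) = c ^ 2 := by
    intro t ht
    rw [← hspeed t ht, Real.sq_sqrt (lieForm_self_nonneg hk.le (velocity_mem hγ hM ht))]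
  have hL : curveLength (gM k) γ 0 1 = c := by
    have e : curveLength (gM k) γ 0 1 = ∫ _t in (0 : ℝ)..1, Real.sqrt (c ^ 2) :=
      curveLength_eq_integral zero_le_one
        (fun t ht => hasDerivWithinAt_Icc hγ (Ioo_subset_Icc_self ht)) fun t ht => by
          rw [gM_self]
          exact hc2 t (Ioo_subset_Icc_self ht)
    rw [e, Real.sqrt_sq hc0]
    simp
  have hsrc := h.isFMinimal.source
  have htgt := h.isFMinimal.target
  obtain ⟨a, ha, hva, hexp⟩ := exists_eq_expCurve_of_minimal hk hγ hM hc2 hL hc0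
    fun η hη e0 e1 => h.isFMinimal.minimal.trans_le
      (dSR_le_curveLength hη (e0 ▸ hsrc) (e1 ▸ htgt))
  refine ⟨a, ha, fun t ht => h.source_eq ▸ hexp t ht, ?_, ?_, fun B hB hBr => ?_⟩
  · have e : (γ 0).1 * (γ 0).1⁻¹ = 1 :=
      Matrix.mul_nonsing_inv _ (SO.isUnit_det (hM h0).1)
    rw [← hva 0 h0, ← h.source_eq]
    simp only [velocity, leftLog]
    rw [← mul_assoc, e, one_mul]
  · rw [hL, ← hva 0 h0, hspeed 0 h0]
  · have hb : ((B, 0) : Mat p × Mat p) ∈ lieAlg p := ⟨hB, 0, by simp⟩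
    have hid : ∀ t ∈ Icc (0 : ℝ) 1, HasDerivWithinAt (fun t : ℝ => t) 1 (Icc 0 1) t :=
      fun t _ => hasDerivWithinAt_id t _
    have hvar := integral_mul_lieForm_eq_zero hk.le hγ hM hb hc2 hL hc0 hid continuousOn_const
      fun s => h.isFMinimal.minimal.trans_le (dSR_le_curveLength
        (isPiecewiseSmoothIn_of_contDiffOn
          (contDiffOn_perturb hγ (contDiffOn_const.mul contDiffOn_id)) (mapsTo_perturb hM hb))
        (by simpa [perturb] using hsrc) (by
          have e1 := h.target_eq
          have hr : r ∈ fiber Y := e1 ▸ htgt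
          have := mul_exp_mem_fiber (B := s • B) (by simp [hB]) hr (hBr.smul_left s)
          simpa [perturb, e1] using this))
    have hcon : ∫ t in (0 : ℝ)..1, (1 : ℝ) * lieForm k (velocity γ t) (B, 0) =
        ∫ _t in (0 : ℝ)..1, lieForm k a (B, 0) := by
      refine intervalIntegral.integral_congr fun t ht => ?_
      rw [uIcc_of_le zero_le_one] at ht
      simp only [one_mul, hva t ht]
    rw [hcon] at hvar
    simp only [intervalIntegral.integral_const, sub_zero, one_smul, lieForm, mul_zero,
      Matrix.trace_zero, add_zero] at hvar
    exact (mul_eq_zero.1 hvar).resolve_left (by linarith)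

end Minimal

section RotationPart

variable {q a : Mat p × Mat p}

theorem integral_le_of_subdivision {n : ℕ} {t : Fin (n + 1) → ℝ} {f h : ℝ → ℝ}
    (hm : StrictMono t) (h0 : t 0 = 0) (h1 : t (Fin.last n) = 1)
    (hf : IntervalIntegrable f MeasureTheory.volume 0 1)
    (hh : IntervalIntegrable h MeasureTheory.volume 0 1)
    (hle : ∀ i : Fin n, ∀ u ∈ Ioo (t i.castSucc) (t i.succ), f u ≤ h u) :
    ∫ u in (0 : ℝ)..1, f u ≤ ∫ u in (0 : ℝ)..1, h u := by
  have hsub : ∀ i j : Fin (n + 1), i ≤ j → uIcc (t i) (t j) ⊆ uIcc 0 1 := by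
    intro i j hij
    rw [uIcc_of_le (hm.monotone hij), uIcc_of_le zero_le_one, ← h0, ← h1]
    exact Icc_subset_Icc (hm.monotone (Fin.zero_le _)) (hm.monotone (Fin.le_last _))
  have key : ∀ i : Fin (n + 1), ∫ u in (t 0)..(t i), f u ≤ ∫ u in (t 0)..(t i), h u := by
    intro i
    induction i using Fin.induction with
    | zero => simp
    | succ i ih =>
      have hi := (i.castSucc_lt_succ).le
      have s1 := hsub 0 i.castSucc (Fin.zero_le _)
      have s2 := hsub _ _ hi
      rw [← intervalIntegral.integral_add_adjacent_intervals (hf.mono_set s1) (hf.mono_set s2),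
        ← intervalIntegral.integral_add_adjacent_intervals (hh.mono_set s1) (hh.mono_set s2)]
      exact add_le_add ih (intervalIntegral.integral_mono_on_of_le_Ioo (hm.monotone hi)
        (hf.mono_set s2) (hh.mono_set s2) (hle i))
  have := key (Fin.last n)
  rwa [h0, h1] at this

theorem gSO_self_nonneg {U v : Mat p} (h : (U⁻¹ * v)ᵀ = -(U⁻¹ * v)) : 0 ≤ gSO U v v := by
  have e : (U⁻¹ * v * (U⁻¹ * v)).trace = -((U⁻¹ * v)ᵀ * (U⁻¹ * v)).trace := by
    rw [h]
    simp
  have := trace_transpose_mul_self_nonneg (U⁻¹ * v)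
  rw [gSO, e]
  linarith

theorem inv_mul_velocity_skew {η : ℝ → Mat p} {I : Set ℝ} {v : Mat p} {t : ℝ}
    (hI : UniqueDiffWithinAt ℝ I t) (ht : t ∈ I) (hM : MapsTo η I (SO p))
    (h : HasDerivWithinAt η v I t) : ((η t)⁻¹ * v)ᵀ = -((η t)⁻¹ * v) := by
  have hone : (1 : Mat p) ∈ DiagPos p := ⟨1, fun _ => zero_lt_one, by simp⟩
  exact (leftLog_mem_lieAlg (γ := fun u => (η u, 1)) (v := (v, 0)) hI ht
    (fun u hu => ⟨hM hu, hone⟩) (h.prodMk (hasDerivWithinAt_const _ _ _))).1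

theorem sqrt_add_sq_le {x ε : ℝ} (hx : 0 ≤ x) (hε : 0 ≤ ε) :
    Real.sqrt (x + ε ^ 2) ≤ Real.sqrt x + ε := by
  refine Real.sqrt_le_iff.2 ⟨add_nonneg (Real.sqrt_nonneg _) hε, ?_⟩
  have h2 := Real.sq_sqrt hx
  have h3 := mul_nonneg (Real.sqrt_nonneg x) hε
  nlinarith

/-- The smoothing `√(|η'|² + ε²)` of the speed of a curve in `SO(p)`. -/
noncomputable def smoothedSpeed (η : ℝ → Mat p) (ε t : ℝ) : ℝ :=
  Real.sqrt (gSO (η t) (deriv η t) (deriv η t) + ε ^ 2)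

theorem contDiffOn_gSO_derivWithin {η : ℝ → Mat p} {x y : ℝ} (hxy : x < y)
    (hη : ContDiffOn ℝ ∞ η (Icc x y)) (hM : MapsTo η (Icc x y) (SO p)) :
    ContDiffOn ℝ ∞ (fun t => gSO (η t) (derivWithin η (Icc x y) t) (derivWithin η (Icc x y) t))
      (Icc x y) := by
  have hd : ContDiffOn ℝ ∞ (derivWithin η (Icc x y)) (Icc x y) :=
    ((contDiffOn_infty_iff_derivWithin (uniqueDiffOn_Icc hxy)).1 hη).2
  have h1 : ContDiffOn ℝ ∞ (fun t => (η t)⁻¹) (Icc x y) :=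
    contDiffOn_inv.comp hη fun t ht => SO.isUnit (hM ht)
  exact contDiffOn_const.mul (contDiff_trace.comp_contDiffOn ((h1.mul hd).mul (h1.mul hd)))

/-- On a smooth piece the smoothed speed agrees, up to the endpoints, with a smooth positive
function. -/
theorem exists_smooth_eq_smoothedSpeed {η : ℝ → Mat p} {x y ε : ℝ} (hε : 0 < ε) (hxy : x < y)
    (hη : ContDiffOn ℝ ∞ η (Icc x y)) (hM : MapsTo η (Icc x y) (SO p)) :
    ∃ h : ℝ → ℝ, ContDiffOn ℝ ∞ h (Icc x y) ∧ ∀ t ∈ Ioo x y, smoothedSpeed η ε t = h t := by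
  refine ⟨fun t => Real.sqrt
    (gSO (η t) (derivWithin η (Icc x y) t) (derivWithin η (Icc x y) t) + ε ^ 2), ?_, ?_⟩
  · refine ((contDiffOn_gSO_derivWithin hxy hη hM).add contDiffOn_const).sqrt fun t ht => ?_
    have := gSO_self_nonneg (inv_mul_velocity_skew (uniqueDiffOn_Icc hxy t ht) ht hM
      (hη.differentiableOn (by simp) t ht).hasDerivWithinAt)
    positivity
  · intro t ht
    exact congrArg (fun v => Real.sqrt (gSO (η t) v v + ε ^ 2))
      (derivWithin_of_mem_nhds (Icc_mem_nhds ht.1 ht.2)).symm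

/-- If `t ↦ q · exp (t a)` is shortest in `M(p)` between its endpoints, then its rotation part is
shortest in `SO(p)`. A competitor `η` in `SO(p)` is paired with the diagonal part, reparametrized
so that it advances proportionally to the smoothed arc length of `η`; this makes the speeds of the
two components nearly proportional, so that their lengths combine by the Pythagorean rule. -/
theorem sqrt_le_curveLength_gSO (hk : 0 < k) (hq : q ∈ M p) (ha : a ∈ lieAlg p)
    (hmin : ∀ ζ, IsPiecewiseSmoothIn (M p) ζ → ζ 0 = q → ζ 1 = expCurve q a 1 →
      Real.sqrt (lieForm k a a) ≤ curveLength (gM k) ζ 0 1)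
    {η : ℝ → Mat p} (hη : IsPiecewiseSmoothIn (SO p) η) (h0 : η 0 = q.1)
    (h1 : η 1 = q.1 * exp a.1) :
    Real.sqrt (-(1 / 2) * (a.1 * a.1).trace) ≤ curveLength gSO η 0 1 := by
  refine le_of_forall_pos_le_add fun ε hε => ?_
  obtain ⟨hS, n, τ, hτ, hτ0, hτ1, hs⟩ := id hη
  have hpiece : ∀ i : Fin n, MapsTo η (Icc (τ i.castSucc) (τ i.succ)) (SO p) := fun i =>
    hS.mono_left (IsPiecewiseSmoothIn.subdivision_subset hτ hτ0 hτ1 i)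
  set h := smoothedSpeed η ε with hh
  have hsp := hη.intervalIntegrable_speed continuousOn_gSO
  have hhi : ∀ i : Fin n, IntervalIntegrable h MeasureTheory.volume (τ i.castSucc) (τ i.succ) := by
    intro i
    have hi := hτ i.castSucc_lt_succ
    obtain ⟨f, hf, hfe⟩ := exists_smooth_eq_smoothedSpeed hε hi (hs i) (hpiece i)
    refine (hf.continuousOn.intervalIntegrable_of_Icc hi.le).congr_uIoo fun t ht => ?_
    rw [uIoo_of_le hi.le] at ht
    exact (hfe t ht).symm
  have hint : IntervalIntegrable h MeasureTheory.volume 0 1 :=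
    intervalIntegrable_of_subdivision hτ0 hτ1 hhi
  set N := ∫ t in (0 : ℝ)..1, h t with hN
  have hderiv : ∀ i : Fin n, ∀ t ∈ Ioo (τ i.castSucc) (τ i.succ), HasDerivAt η (deriv η t) t := by
    intro i t ht
    exact (((hs i).differentiableOn (by simp) t (Ioo_subset_Icc_self ht)).differentiableAt
      (Icc_mem_nhds ht.1 ht.2)).hasDerivAt
  have hnn : ∀ i : Fin n, ∀ t ∈ Ioo (τ i.castSucc) (τ i.succ),
      0 ≤ gSO (η t) (deriv η t) (deriv η t) := by
    intro i t ht
    have hi := hτ i.castSucc_lt_succ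
    have ht' := Ioo_subset_Icc_self ht
    exact gSO_self_nonneg (inv_mul_velocity_skew (uniqueDiffOn_Icc hi t ht') ht' (hpiece i)
      (hderiv i t ht).hasDerivWithinAt)
  have hNε : ε ≤ N := by
    have := integral_le_of_subdivision hτ hτ0 hτ1 (f := fun _ => ε) (by simp) hint
      fun i t ht => Real.le_sqrt_of_sq_le (by linarith [hnn i t ht])
    simpa using this
  have hN0 : 0 < N := hε.trans_le hNε
  have hNle : N ≤ curveLength gSO η 0 1 + ε := by
    have := integral_le_of_subdivision hτ hτ0 hτ1 hint (hsp.add (f := _) (g := fun _ => ε) (by simp))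
      fun i t ht => sqrt_add_sq_le (hnn i t ht) hε.le
    rw [intervalIntegral.integral_add hsp (by simp)] at this
    simpa [curveLength] using this
  refine le_trans ?_ hNle
  -- The profile along which the diagonal part advances.
  set σ : ℝ → ℝ := fun t => N⁻¹ * ∫ u in (0 : ℝ)..t, h u with hσ
  have hσs : ∀ i : Fin n, ContDiffOn ℝ ∞ σ (Icc (τ i.castSucc) (τ i.succ)) ∧
      ∀ t ∈ Ioo (τ i.castSucc) (τ i.succ), HasDerivAt σ (N⁻¹ * h t) t := by
    intro i
    have hi := hτ i.castSucc_lt_succ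
    obtain ⟨f, hf, hfe⟩ := exists_smooth_eq_smoothedSpeed hε hi (hs i) (hpiece i)
    have hst := IsPiecewiseSmoothIn.subdivision_subset hτ hτ0 hτ1 i
    have e : ∀ t ∈ Icc (τ i.castSucc) (τ i.succ), σ t =
        N⁻¹ * (∫ u in (0 : ℝ)..τ i.castSucc, h u) + N⁻¹ * ∫ u in (τ i.castSucc)..t, f u := by
      intro t ht
      have ht1 := hst ht
      have hx := hst (left_mem_Icc.2 hi.le)
      have e1 : ∫ u in (τ i.castSucc)..t, f u = ∫ u in (τ i.castSucc)..t, h u :=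
        intervalIntegral.integral_congr_Ioo_of_le ht.1 fun u hu =>
          (hfe u ⟨hu.1, hu.2.trans_le ht.2⟩).symm
      rw [e1, ← mul_add, intervalIntegral.integral_add_adjacent_intervals]
      · refine hint.mono_set ?_
        rw [uIcc_of_le hx.1, uIcc_of_le zero_le_one]
        exact Icc_subset_Icc le_rfl hx.2
      · refine hint.mono_set ?_
        rw [uIcc_of_le ht.1, uIcc_of_le zero_le_one]
        exact Icc_subset_Icc hx.1 ht1.2
    have hd : ∀ t ∈ Icc (τ i.castSucc) (τ i.succ),
        HasDerivWithinAt σ (N⁻¹ * f t) (Icc (τ i.castSucc) (τ i.succ)) t := by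
      intro t ht
      exact (((hasDerivWithinAt_integral hf.continuousOn ht).const_mul N⁻¹).const_add
        _).congr_of_mem e ht
    refine ⟨contDiffOn_of_hasDerivWithinAt hi hd (contDiffOn_const.mul hf), fun t ht => ?_⟩
    rw [hh, hfe t ht]
    exact (hd t (Ioo_subset_Icc_self ht)).hasDerivAt (Icc_mem_nhds ht.1 ht.2)
  have hb : ((0, a.2) : Mat p × Mat p) ∈ lieAlg p := ⟨by simp, ha.2⟩
  have hMη : MapsTo (fun t => (η t, q.2)) (Icc 0 1) (M p) := fun t ht => ⟨hS ht, hq.2⟩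
  set ζ := perturb (fun t => (η t, q.2)) σ (0, a.2) with hζ
  have hζp : IsPiecewiseSmoothIn (M p) ζ :=
    ⟨mapsTo_perturb hMη hb, n, τ, hτ, hτ0, hτ1, fun i =>
      contDiffOn_perturb ((hs i).prodMk contDiffOn_const) (hσs i).1⟩
  have hσ0 : σ 0 = 0 := by simp [hσ]
  have hσ1 : σ 1 = 1 := by
    simp only [hσ]
    rw [← hN, inv_mul_cancel₀ hN0.ne']
  have hlow := hmin ζ hζp (by simp [hζ, perturb, hσ0, h0])
    (by simp [hζ, perturb, expCurve, hσ1, h1])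
  have ht2 : 0 ≤ (a.2 * a.2).trace := by
    obtain ⟨l, hl⟩ := ha.2
    have := trace_transpose_mul_self_nonneg a.2
    rw [hl] at this ⊢
    simpa using this
  set w := Real.sqrt (k + (N⁻¹) ^ 2 * (a.2 * a.2).trace) with hw
  have hup : curveLength (gM k) ζ 0 1 ≤ N * w := by
    have := integral_le_of_subdivision hτ hτ0 hτ1 (hζp.intervalIntegrable_speed
      (continuousOn_gM (k := k))) (hint.mul_const w) fun i t ht => by
        have hd := hasDerivWithinAt_perturb (a := (0, a.2))
          (((hderiv i t ht).prodMk (hasDerivAt_const t q.2)).hasDerivWithinAt (s := univ))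
          ((hσs i).2 t ht).hasDerivWithinAt
        have hd' := hasDerivWithinAt_univ.1 hd
        have ht' : t ∈ Icc (0 : ℝ) 1 :=
          IsPiecewiseSmoothIn.subdivision_subset hτ hτ0 hτ1 i (Ioo_subset_Icc_self ht)
        have hg := gM_perturb (k := k) (γ := fun t => (η t, q.2)) (θ := σ) (a := (0, a.2))
          (v := (deriv η t, 0)) (N⁻¹ * h t) (hMη ht')
        have hder : deriv ζ t = _ := hd'.deriv
        have h1 := hnn i t ht
        have hht : h t ^ 2 = gSO (η t) (deriv η t) (deriv η t) + ε ^ 2 :=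
          Real.sq_sqrt (by positivity)
        have hh0 : 0 ≤ h t := Real.sqrt_nonneg _
        refine (congrArg (fun v => Real.sqrt (gM k (ζ t) v v)) hder).trans_le ?_
        refine Real.sqrt_le_iff.2 ⟨mul_nonneg hh0 (Real.sqrt_nonneg _), ?_⟩
        refine hg.trans_le ?_
        have hw2 : w ^ 2 = k + (N⁻¹) ^ 2 * (a.2 * a.2).trace := Real.sq_sqrt (by positivity)
        have e1 : lieForm k (leftLog (η t, q.2) (deriv η t, 0))
            (leftLog (η t, q.2) (deriv η t, 0)) = k * gSO (η t) (deriv η t) (deriv η t) := by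
          simp only [lieForm, leftLog, gSO, mul_zero, Matrix.trace_zero]
          ring
        have e2 : lieForm k (leftLog (η t, q.2) (deriv η t, 0)) (0, a.2) = 0 := by
          simp [lieForm, leftLog]
        have e3 : lieForm k ((0, a.2) : Mat p × Mat p) (0, a.2) = (a.2 * a.2).trace := by
          simp [lieForm]
        have e4 : (h t * w) ^ 2 = k * gSO (η t) (deriv η t) (deriv η t) + k * ε ^ 2 +
            (N⁻¹ * h t) ^ 2 * (a.2 * a.2).trace := by
          rw [mul_pow, hw2, mul_pow, hht]
          ring
        have := mul_nonneg hk.le (sq_nonneg ε)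
        rw [e1, e2, e3, e4]
        linarith
    rwa [intervalIntegral.integral_mul_const] at this
  have h3 := hlow.trans hup
  have h4 : lieForm k a a ≤ (N * w) ^ 2 :=
    (Real.sqrt_le_left (mul_nonneg hN0.le (Real.sqrt_nonneg _))).1 h3
  rw [mul_pow, hw, Real.sq_sqrt (by positivity), mul_add, ← mul_assoc, ← mul_pow,
    mul_inv_cancel₀ hN0.ne', lieForm] at h4
  refine Real.sqrt_le_iff.2 ⟨hN0.le, ?_⟩
  have h5 : k * (-(1 / 2) * (a.1 * a.1).trace) ≤ k * N ^ 2 := by linarith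
  exact le_of_mul_le_mul_left h5 hk

end RotationPart

end ScalingRotation

/-! ### Translations and the cut locus of `SO(p)` -/

namespace ScalingRotation

variable {p : ℕ}

section Translations

/-- Right translation by an invertible matrix. -/
noncomputable def rightMul (Q Q' : Mat p) (h : Q * Q' = 1) : Mat p ≃L[ℝ] Mat p :=
  LinearEquiv.toContinuousLinearEquiv
    { toFun := fun A => A * Q
      invFun := fun A => A * Q'
      map_add' := fun A B => add_mul A B Q
      map_smul' := fun r A => smul_mul_assoc r A Q
      left_inv := fun A => by beta_reduce; rw [mul_assoc, h, mul_one]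
      right_inv := fun A => by beta_reduce; rw [mul_assoc, mul_eq_one_comm.1 h, mul_one] }

/-- Left translation by an invertible matrix. -/
noncomputable def leftMul (Q Q' : Mat p) (h : Q * Q' = 1) : Mat p ≃L[ℝ] Mat p :=
  LinearEquiv.toContinuousLinearEquiv
    { toFun := fun A => Q * A
      invFun := fun A => Q' * A
      map_add' := fun A B => mul_add Q A B
      map_smul' := fun r A => mul_smul_comm r Q A
      left_inv := fun A => by beta_reduce; rw [← mul_assoc, mul_eq_one_comm.1 h, one_mul]
      right_inv := fun A => by beta_reduce; rw [← mul_assoc, h, one_mul] }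

theorem gSO_mul_right {Q : Mat p} (hQ : Q ∈ SO p) (U v : Mat p) :
    gSO (U * Q) (v * Q) (v * Q) = gSO U v v := by
  have h1 : Q * Q⁻¹ = 1 := Matrix.mul_nonsing_inv _ (SO.isUnit_det hQ)
  have h2 : (U * Q)⁻¹ * (v * Q) * ((U * Q)⁻¹ * (v * Q)) =
      Q⁻¹ * (U⁻¹ * v * (Q * Q⁻¹) * (U⁻¹ * v) * Q) := by
    rw [Matrix.mul_inv_rev]
    noncomm_ring
  rw [gSO, gSO, h2, h1, Matrix.trace_mul_comm, mul_one, mul_assoc _ Q, h1, mul_one]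

theorem gSO_mul_left {Q : Mat p} (hQ : Q ∈ SO p) (U v : Mat p) :
    gSO (Q * U) (Q * v) (Q * v) = gSO U v v := by
  have h1 : Q⁻¹ * Q = 1 := Matrix.nonsing_inv_mul _ (SO.isUnit_det hQ)
  have h2 : (Q * U)⁻¹ * (Q * v) = U⁻¹ * v := by
    rw [Matrix.mul_inv_rev, mul_assoc, ← mul_assoc Q⁻¹, h1, one_mul]
  rw [gSO, gSO, h2]

theorem mul_mem_SO_iff_left {Q : Mat p} (hQ : Q ∈ SO p) (U : Mat p) : U * Q ∈ SO p ↔ U ∈ SO p := by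
  refine ⟨fun h => ?_, fun h => SO.mul_mem h hQ⟩
  have := SO.mul_mem h (SO.transpose_mem hQ)
  rwa [mul_assoc, SO.mul_transpose hQ, mul_one] at this

theorem mul_mem_SO_iff_right {Q : Mat p} (hQ : Q ∈ SO p) (U : Mat p) : Q * U ∈ SO p ↔ U ∈ SO p := by
  refine ⟨fun h => ?_, fun h => SO.mul_mem hQ h⟩
  have := SO.mul_mem (SO.transpose_mem hQ) h
  rwa [← mul_assoc, SO.transpose_mul hQ, one_mul] at this

theorem GeodesicallyAntipodal.mul_right {U V Q : Mat p} (hQ : Q ∈ SO p)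
    (h : GeodesicallyAntipodal U V) : GeodesicallyAntipodal (U * Q) (V * Q) := by
  have hmem : ∀ {x y : Mat p}, y ∈ cutLocus (SO p) gSO x →
      y * Q ∈ cutLocus (SO p) gSO (x * Q) := fun hy =>
    mem_cutLocus_of_equiv (rightMul Q Qᵀ (SO.mul_transpose hQ)) (gSO_mul_right hQ)
      (mul_mem_SO_iff_left hQ) hy
  exact h.imp hmem hmem

theorem geodesicDist_mul_left {Q : Mat p} (hQ : Q ∈ SO p) (x y : Mat p) :
    geodesicDist (SO p) gSO (Q * x) (Q * y) = geodesicDist (SO p) gSO x y :=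
  geodesicDist_equiv (leftMul Q Qᵀ (SO.mul_transpose hQ)) (gSO_mul_left hQ)
    (mul_mem_SO_iff_right hQ) x y

end Translations

section CutLocus

variable {W A B C : Mat p}

theorem contDiff_mul_exp_mul_exp (W B C : Mat p) (m n : ℝ) :
    ContDiff ℝ ∞ fun t : ℝ => W * exp (t • B) * exp ((m * t + n) • C) := by
  have h1 : ContDiff ℝ ∞ fun t : ℝ => exp (t • B) :=
    contDiff_exp_mat.comp (contDiff_id.smul contDiff_const)
  have h2 : ContDiff ℝ ∞ fun t : ℝ => exp ((m * t + n) • C) :=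
    contDiff_exp_mat.comp (((contDiff_const.mul contDiff_id).add contDiff_const).smul
      contDiff_const)
  exact (contDiff_const.mul h1).mul h2

theorem mul_exp_mul_exp_mem (hW : W ∈ SO p) (hB : Bᵀ = -B) (hC : Cᵀ = -C) (t s : ℝ) :
    W * exp (t • B) * exp (s • C) ∈ SO p :=
  SO.mul_mem (SO.mul_mem hW (exp_skew_mem (by simp [hB]))) (exp_skew_mem (by simp [hC]))

theorem exists_velocity_mul_exp_mul_exp (hW : W ∈ SO p) (hB : Bᵀ = -B) (m n t : ℝ) :
    ∃ v, HasDerivAt (fun t : ℝ => W * exp (t • B) * exp ((m * t + n) • C)) v t ∧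
      gSO (W * exp (t • B) * exp ((m * t + n) • C)) v v =
        -(1 / 2) * ((B * B).trace + 2 * m * (B * C).trace + m ^ 2 * (C * C).trace) := by
  have hP : HasDerivAt (fun t : ℝ => W * exp (t • B)) (W * (exp (t • B) * B)) t :=
    (hasDerivAt_exp_smul B t).const_mul W
  have hθ : HasDerivAt (fun t : ℝ => m * t + n) m t := by
    simpa using ((hasDerivAt_id t).const_mul m).add_const n
  have hd := hasDerivWithinAt_mul_exp C (hP.hasDerivWithinAt (s := univ))
    (hθ.hasDerivWithinAt (s := univ))
  refine ⟨_, hasDerivWithinAt_univ.1 hd, ?_⟩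
  have hWB : W * exp (t • B) ∈ SO p := SO.mul_mem hW (exp_skew_mem (by simp [hB]))
  have hB' : (W * exp (t • B))⁻¹ * (W * (exp (t • B) * B)) = B := by
    rw [← mul_assoc W, ← mul_assoc, Matrix.nonsing_inv_mul _ (SO.isUnit_det hWB), one_mul]
  rw [gSO, leftLog_mul_exp (SO.isUnit hWB), hB',
    trace_sq_conj_add _ (exp_mul_inv _) (commute_exp_smul _ _)]

theorem curveLength_mul_exp_mul_exp (hW : W ∈ SO p) (hB : Bᵀ = -B) (m n : ℝ) {x y : ℝ}
    (hxy : x ≤ y) :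
    curveLength gSO (fun t : ℝ => W * exp (t • B) * exp ((m * t + n) • C)) x y = (y - x) *
      Real.sqrt (-(1 / 2) * ((B * B).trace + 2 * m * (B * C).trace +
        m ^ 2 * (C * C).trace)) := by
  choose v hv hg using exists_velocity_mul_exp_mul_exp (C := C) hW hB m n
  have := curveLength_eq_integral (g := gSO) hxy (fun t _ => (hv t).hasDerivWithinAt)
    fun t _ => hg t
  rw [this, intervalIntegral.integral_const, smul_eq_mul]

theorem mul_exp_eq (W A : Mat p) : (fun t : ℝ => W * exp (t • A)) =
    fun t : ℝ => W * exp (t • A) * exp (((0 : ℝ) * t + 0) • (0 : Mat p)) := by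
  funext t
  rw [smul_zero, NormedSpace.exp_zero, mul_one]

theorem contDiff_mul_exp (W A : Mat p) : ContDiff ℝ ∞ fun t : ℝ => W * exp (t • A) := by
  rw [mul_exp_eq]
  exact contDiff_mul_exp_mul_exp _ _ _ _ _

theorem curveLength_mul_exp (hW : W ∈ SO p) (hA : Aᵀ = -A) {x y : ℝ} (hxy : x ≤ y) :
    curveLength gSO (fun t : ℝ => W * exp (t • A)) x y =
      (y - x) * Real.sqrt (-(1 / 2) * (A * A).trace) := by
  rw [mul_exp_eq, curveLength_mul_exp_mul_exp hW hA _ _ hxy]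
  simp

theorem mul_exp_mem (hW : W ∈ SO p) (hA : Aᵀ = -A) (t : ℝ) : W * exp (t • A) ∈ SO p :=
  SO.mul_mem hW (exp_skew_mem (by simp [hA]))

theorem geodesicDist_mul_exp_le (hW : W ∈ SO p) (hA : Aᵀ = -A) {x y : ℝ} (hxy : x ≤ y) :
    geodesicDist (SO p) gSO (W * exp (x • A)) (W * exp (y • A)) ≤
      (y - x) * Real.sqrt (-(1 / 2) * (A * A).trace) := by
  rcases hxy.eq_or_lt with rfl | hlt
  · -- The constant curve is written as the one-parameter subgroup of the zero matrix.
    have h0 : (0 : Mat p)ᵀ = -0 := by simp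
    have hP := mul_exp_mem hW hA x
    have h1 := geodesicDist_le_of_contDiffOn gSO_smul zero_lt_one
      (contDiff_mul_exp (W * exp (x • A)) 0).contDiffOn (fun t _ => mul_exp_mem hP h0 t)
    rw [curveLength_mul_exp hP h0 zero_le_one] at h1
    simpa using h1
  · rw [← curveLength_mul_exp hW hA hxy]
    exact geodesicDist_le_of_contDiffOn gSO_smul hlt (contDiff_mul_exp W A).contDiffOn
      fun t _ => mul_exp_mem hW hA t

/-- A one-parameter subgroup that is shortest on `[0, 1]` is shortest on every interval of length
at most one, by homogeneity and the triangle inequality. -/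
theorem geodesicDist_mul_exp_eq (hW : W ∈ SO p) (hA : Aᵀ = -A)
    (hmin : Real.sqrt (-(1 / 2) * (A * A).trace) ≤
      geodesicDist (SO p) gSO W (W * exp A)) {x y : ℝ} (hxy : x ≤ y) (hyx : y < x + 1) :
    geodesicDist (SO p) gSO (W * exp (x • A)) (W * exp (y • A)) =
      (y - x) * Real.sqrt (-(1 / 2) * (A * A).trace) := by
  refine le_antisymm (geodesicDist_mul_exp_le hW hA hxy) ?_
  have hQ : W * exp (x • A) * Wᵀ ∈ SO p :=
    SO.mul_mem (mul_exp_mem hW hA x) (SO.transpose_mem hW)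
  have e : ∀ u : ℝ, W * exp ((x + u) • A) = W * exp (x • A) * Wᵀ * (W * exp (u • A)) := by
    intro u
    rw [add_smul, Matrix.exp_add_of_commute _ _ (((Commute.refl A).smul_left x).smul_right u)]
    calc W * (exp (x • A) * exp (u • A)) = W * exp (x • A) * 1 * exp (u • A) := by noncomm_ring
      _ = W * exp (x • A) * (Wᵀ * W) * exp (u • A) := by rw [SO.transpose_mul hW]
      _ = W * exp (x • A) * Wᵀ * (W * exp (u • A)) := by noncomm_ring
  have e0 := e 0
  have e1 := e (y - x)
  rw [add_zero] at e0
  rw [add_sub_cancel] at e1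
  rw [e0, e1, geodesicDist_mul_left hQ, zero_smul, NormedSpace.exp_zero, mul_one]
  have hcont := contDiff_mul_exp W A
  have hS : ∀ t, W * exp (t • A) ∈ SO p := mul_exp_mem hW hA
  have hpath : ∃ η, IsPiecewiseSmoothIn (SO p) η ∧ η 0 = W ∧ η 1 = W * exp ((y - x) • A) := by
    refine ⟨fun t => W * exp (t • ((y - x) • A)), isPiecewiseSmoothIn_of_contDiffOn
      (contDiff_mul_exp _ _).contDiffOn fun t _ => mul_exp_mem hW (by simp [hA]) t, ?_, ?_⟩
    · simp
    · simp
  have h1 := geodesicDist_triangle_of_contDiffOn (c := fun t : ℝ => W * exp (t • A)) gSO_smul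
    continuousOn_gSO hpath (by linarith : y - x < 1) hcont.contDiffOn fun t _ => hS t
  rw [curveLength_mul_exp hW hA (by linarith), one_smul] at h1
  linarith

/-- Two distinct one-parameter subgroups of equal speed that are shortest up to a common endpoint
force this endpoint into the cut locus: beyond it, one can follow the other subgroup and cut the
corner. -/
theorem mul_exp_mem_cutLocus (hW : W ∈ SO p) (hA : Aᵀ = -A) (hB : Bᵀ = -B)
    (hAB : exp A = exp B) (hne : A ≠ B) (htr : (A * A).trace = (B * B).trace)
    (hmin : Real.sqrt (-(1 / 2) * (A * A).trace) ≤
      geodesicDist (SO p) gSO W (W * exp A)) :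
    W * exp A ∈ cutLocus (SO p) gSO W := by
  set s := Real.sqrt (-(1 / 2) * (A * A).trace) with hs
  have hAA : 0 ≤ -(1 / 2) * (A * A).trace := by
    have := trace_transpose_mul_self_nonneg A
    rw [hA, neg_mul, Matrix.trace_neg] at this
    linarith
  have hs2 : s ^ 2 = -(1 / 2) * (A * A).trace := Real.sq_sqrt hAA
  choose v hv hg using exists_velocity_mul_exp_mul_exp (C := 0) hW hA 0 0
  have hv' : ∀ t, HasDerivAt (fun t : ℝ => W * exp (t • A)) (v t) t := fun t => by
    rw [mul_exp_eq]
    exact hv t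
  have hg' : ∀ t : ℝ, gSO (W * exp (t • A)) (v t) (v t) = -(1 / 2) * (A * A).trace := fun t => by
    have := hg t
    rw [smul_zero, NormedSpace.exp_zero, mul_one] at this
    rw [this]
    simp
  refine ⟨fun t => W * exp (t • A), ⟨fun t _ => mul_exp_mem hW hA t,
    (contDiff_mul_exp W A).contDiffOn, ⟨s, fun t ht => ?_⟩, fun t _ => ⟨1 / 2, by norm_num,
    fun x _ y _ hx hy hxy => ?_⟩⟩, by simp, by simp, ?_, fun T hT => ?_⟩
  · have hd : derivWithin (fun t : ℝ => W * exp (t • A)) (Ici 0) t = v t :=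
      (hv' t).hasDerivWithinAt.derivWithin (uniqueDiffOn_Ici 0 t ht)
    exact (congrArg (fun v => Real.sqrt (gSO (W * exp (t • A)) v v)) hd).trans
      (congrArg Real.sqrt (hg' t))
  · rw [curveLength_mul_exp hW hA hxy, geodesicDist_mul_exp_eq hW hA hmin hxy]
    rw [abs_lt] at hx hy
    linarith
  · rw [curveLength_mul_exp hW hA zero_le_one, sub_zero, one_mul]
    refine le_antisymm hmin ?_
    have := geodesicDist_mul_exp_le hW hA zero_le_one
    simpa using this
  · rw [curveLength_mul_exp hW hA (by linarith), sub_zero, ← hs]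
    set C := A - B with hC
    have hCs : Cᵀ = -C := by
      rw [hC, Matrix.transpose_sub, hA, hB]
      abel
    -- The first-order gain from cutting the corner.
    set δ := s ^ 2 + 1 / 2 * (A * B).trace with hδ
    have hBC : (B * C).trace = 2 * δ := by
      rw [hC, mul_sub, Matrix.trace_sub, Matrix.trace_mul_comm B A, ← htr, hδ, hs2]
      ring
    have hAC : (A * C).trace = -(2 * δ) := by
      rw [hC, mul_sub, Matrix.trace_sub, hδ, hs2]
      ring
    have hCC : (C * C).trace = -(4 * δ) := by
      nth_rewrite 1 [hC]
      rw [sub_mul, Matrix.trace_sub, hAC, hBC]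
      ring
    have hδ0 : 0 < δ := by
      have h1 := trace_transpose_mul_self_nonneg C
      rw [hCs, neg_mul, Matrix.trace_neg, hCC] at h1
      refine lt_of_le_of_ne (by linarith) fun h0 => hne (sub_eq_zero.1 ?_)
      refine trace_transpose_mul_self_eq_zero (A := A - B) ?_
      rw [← hC, hCs, neg_mul, Matrix.trace_neg, hCC, ← h0]
      simp
    set τ := 1 / (2 * T) with hτ
    have hT0 : 0 < T := by linarith
    have hτ0 : 0 < τ := by positivity
    have hτT : τ * T = 1 / 2 := by
      rw [hτ]
      field_simp
    have hτ1 : τ < 1 := by nlinarith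
    have hT1 : 0 < T - 1 := by linarith
    have hle := geodesicDist_le_add (S := SO p)
      (η := fun t : ℝ => W * exp (t • B) * exp ((τ * (T - 1) * t + 0) • C))
      (c := fun t : ℝ => W * exp (t • A) * exp ((-τ * t + τ * T) • C)) gSO_smul continuousOn_gSO
      (isPiecewiseSmoothIn_of_contDiffOn (contDiff_mul_exp_mul_exp _ _ _ _ _).contDiffOn
        fun t _ => mul_exp_mul_exp_mem hW hB hCs _ _) hT
      (contDiff_mul_exp_mul_exp _ _ _ _ _).contDiffOn
      (fun t _ => mul_exp_mul_exp_mem hW hA hCs _ _) (by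
        have : -τ * 1 + τ * T = τ * (T - 1) * 1 + 0 := by ring
        simp only [this, one_smul, hAB])
    rw [curveLength_mul_exp_mul_exp hW hB _ _ zero_le_one,
      curveLength_mul_exp_mul_exp hW hA _ _ hT.le] at hle
    have hTT : -τ * T + τ * T = 0 := by ring
    simp only [zero_smul, mul_zero, add_zero, NormedSpace.exp_zero, mul_one, hTT, sub_zero,
      one_mul] at hle
    refine hle.trans_lt ?_
    have hlt : ∀ x : ℝ, x < s ^ 2 → Real.sqrt x < s := fun x hx => by
      have hs0 : 0 ≤ s := Real.sqrt_nonneg _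
      rcases le_or_gt x 0 with h | h
      · rw [Real.sqrt_eq_zero_of_nonpos h]
        refine lt_of_le_of_ne hs0 fun h0 => ?_
        have e1 : s ^ 2 = 0 := by rw [← h0]; norm_num
        -- If the speed were zero, both matrices would vanish.
        have z : ∀ {E : Mat p}, Eᵀ = -E → (E * E).trace = 0 → E = 0 := fun hE h => by
          refine trace_transpose_mul_self_eq_zero ?_
          rw [hE, neg_mul, Matrix.trace_neg, h, neg_zero]
        have hA0 : (A * A).trace = 0 := by linarith
        exact hne ((z hA hA0).trans (z hB (htr ▸ hA0)).symm)
      · exact (Real.sqrt_lt' (lt_of_le_of_ne hs0 fun h0 => by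
          rw [← h0] at hx; norm_num at hx; linarith)).2 hx
    have hm1 : 0 < τ * (T - 1) := mul_pos hτ0 hT1
    have hm2 : τ * (T - 1) < 1 := by linarith
    have l1 := hlt (-(1 / 2) * ((B * B).trace + 2 * (τ * (T - 1)) * (B * C).trace +
        (τ * (T - 1)) ^ 2 * (C * C).trace)) (by
      rw [← htr, hBC, hCC, hs2]
      have := mul_pos (mul_pos hm1 (sub_pos.2 hm2)) hδ0
      nlinarith)
    have l2 := hlt (-(1 / 2) * ((A * A).trace + 2 * -τ * (A * C).trace +
        (-τ) ^ 2 * (C * C).trace)) (by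
      rw [hAC, hCC, hs2]
      have := mul_pos (mul_pos hτ0 (sub_pos.2 hτ1)) hδ0
      nlinarith)
    have l3 := mul_lt_mul_of_pos_left l2 hT1
    linarith

end CutLocus

end ScalingRotation

/-! ### Signed permutations and families of conjugate matrices -/

namespace ScalingRotation

variable {p : ℕ} {k : ℝ}

section SignedPermutations

/-- The permutation matrix with `P e_j = e_{π(j)}`. -/
def permMat (π : Equiv.Perm (Fin p)) : Mat p := Matrix.of fun i j => if i = π j then 1 else 0

theorem mul_permMat_apply (A : Mat p) (π : Equiv.Perm (Fin p)) (i j : Fin p) :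
    (A * permMat π) i j = A i (π j) := by
  simp [Matrix.mul_apply, permMat]

theorem permMat_mul_transpose (π : Equiv.Perm (Fin p)) : permMat π * (permMat π)ᵀ = 1 := by
  rw [mul_eq_one_comm]
  ext i j
  rw [mul_permMat_apply]
  simp [permMat, Matrix.one_apply, eq_comm]

theorem det_permMat (π : Equiv.Perm (Fin p)) :
    (permMat π).det = ((Equiv.Perm.sign π : ℤ) : ℝ) := by
  rw [← Matrix.det_permutation π, ← Matrix.det_transpose]
  congr 1
  ext i j
  simp [permMat, PEquiv.toMatrix_apply, Equiv.toPEquiv_apply, eq_comm]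

theorem EvenSignedPerm.mat_eq (g : EvenSignedPerm p) :
    g.mat = permMat g.perm * signMat fun i => g.sign (g.perm i) := by
  ext i j
  rw [signMat, Matrix.mul_diagonal]
  by_cases h : i = g.perm j
  · simp [EvenSignedPerm.mat, permMat, h]
  · simp [EvenSignedPerm.mat, permMat, h]

theorem EvenSignedPerm.mat_mul_transpose (g : EvenSignedPerm p) : g.mat * g.matᵀ = 1 := by
  rw [g.mat_eq, Matrix.transpose_mul]
  have h : (signMat fun i => g.sign (g.perm i))ᵀ = signMat fun i => g.sign (g.perm i) :=
    Matrix.diagonal_transpose _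
  rw [h, mul_assoc, ← mul_assoc (signMat _), signMat_mul_self, one_mul, permMat_mul_transpose]

theorem EvenSignedPerm.mul_inv (g : EvenSignedPerm p) : g.mat * g.mat⁻¹ = 1 := by
  rw [Matrix.inv_eq_right_inv g.mat_mul_transpose, g.mat_mul_transpose]

theorem EvenSignedPerm.mat_mul_diagonal (g : EvenSignedPerm p) {e e' : Fin p → ℝ}
    (h : ∀ i, e' i = e (g.perm.symm i)) :
    g.mat * Matrix.diagonal e = Matrix.diagonal e' * g.mat := by
  rw [mul_diagonal_eq_iff]
  intro i j hne
  refine if_neg fun hij => hne ?_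
  rw [h, hij, Equiv.symm_apply_apply]

/-- A signed permutation matrix of determinant one is the matrix of an even signed permutation. -/
theorem exists_evenSignedPerm (π : Equiv.Perm (Fin p)) (s : Fin p → ℤˣ)
    (h : (permMat π * signMat s).det = 1) :
    ∃ g : EvenSignedPerm p, g.perm = π ∧ g.mat = permMat π * signMat s := by
  have he : (∏ i, s (π.symm i)) * Equiv.Perm.sign π = 1 := by
    rw [Equiv.prod_comp π.symm s]
    rw [Matrix.det_mul, det_permMat, signMat, Matrix.det_diagonal] at h
    refine Units.ext ?_
    have h' : (((Equiv.Perm.sign π : ℤ) * ∏ i, (s i : ℤ) : ℤ) : ℝ) = ((1 : ℤ) : ℝ) := by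
      push_cast
      exact h
    have := Int.cast_injective h'
    push_cast
    rw [mul_comm]
    exact this
  refine ⟨⟨fun i => s (π.symm i), π, he⟩, rfl, ?_⟩
  rw [EvenSignedPerm.mat_eq]
  simp

end SignedPermutations

section Eigenvalues

/-- Conjugate diagonal matrices have the same entries up to a permutation: a nonzero term of the
Leibniz expansion of the determinant of the conjugating matrix provides it. -/
theorem exists_perm_of_mul_diagonal_eq {N : Mat p} (hN : N.det ≠ 0) {e e' : Fin p → ℝ}
    (h : N * Matrix.diagonal e' = Matrix.diagonal e * N) :
    ∃ σ : Equiv.Perm (Fin p), ∀ j, e' j = e (σ j) := by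
  rw [Matrix.det_apply] at hN
  obtain ⟨σ, -, hσ⟩ := Finset.exists_ne_zero_of_sum_ne_zero hN
  refine ⟨σ, fun j => ?_⟩
  by_contra hne
  refine hσ ?_
  have h0 : N (σ j) j = 0 := mul_diagonal_eq_iff.1 h (σ j) j fun he => hne he.symm
  rw [Finset.prod_eq_zero (f := fun i => N (σ i) i) (Finset.mem_univ j) h0, smul_zero]

/-- Two exponential functions with positive coefficients that agree at two points are equal. -/
theorem eq_and_eq_of_mul_exp_eq {x y a b t t' : ℝ} (hx : 0 < x) (hy : 0 < y) (htt : t ≠ t')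
    (h : x * Real.exp (t * a) = y * Real.exp (t * b))
    (h' : x * Real.exp (t' * a) = y * Real.exp (t' * b)) : x = y ∧ a = b := by
  have e := congrArg Real.log h
  have e' := congrArg Real.log h'
  rw [Real.log_mul hx.ne' (Real.exp_ne_zero _), Real.log_mul hy.ne' (Real.exp_ne_zero _),
    Real.log_exp, Real.log_exp] at e e'
  have hab : (t - t') * (a - b) = 0 := by linarith
  have hab' : a = b := sub_eq_zero.1 ((mul_eq_zero.1 hab).resolve_left (sub_ne_zero.2 htt))
  subst hab'
  exact ⟨mul_right_cancel₀ (Real.exp_ne_zero _) h, rfl⟩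

theorem diagonal_mul_exp (d l : Fin p → ℝ) (t : ℝ) :
    Matrix.diagonal d * exp (t • Matrix.diagonal l) =
      Matrix.diagonal fun j => d j * Real.exp (t * l j) := by
  rw [← Matrix.diagonal_smul, exp_diagonal_eq, Matrix.diagonal_mul_diagonal]
  rfl

end Eigenvalues

section Necessity

variable {d l₁ l₂ : Fin p → ℝ} {Q A₁ A₂ : Mat p}

/-- If the matrices `N(t) = exp(-t A₁) Q exp(t A₂)` conjugate `diag(d e^{t l₂})` into
`diag(d e^{t l₁})` for all `t` in `[0, 1]`, then the two spectra correspond under one permutation,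
and only entries of `N` that link equal eigenvalue functions can be nonzero; so the other entries
of `N(0)` and `N'(0)` vanish. -/
theorem exists_perm_of_conj_family (hd : ∀ i, 0 < d i) (hQ : Q ∈ SO p) (hA₁ : A₁ᵀ = -A₁)
    (hA₂ : A₂ᵀ = -A₂)
    (h : ∀ t ∈ Icc (0 : ℝ) 1,
      exp (t • -A₁) * Q * exp (t • A₂) * Matrix.diagonal (fun j => d j * Real.exp (t * l₂ j)) =
      Matrix.diagonal (fun j => d j * Real.exp (t * l₁ j)) * (exp (t • -A₁) * Q * exp (t • A₂))) :
    ∃ σ : Equiv.Perm (Fin p), (∀ j, d j = d (σ j)) ∧ (∀ j, l₂ j = l₁ (σ j)) ∧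
      ∀ i j, (d i, l₁ i) ≠ (d (σ j), l₁ (σ j)) → Q i j = 0 ∧ (Q * A₂ - A₁ * Q) i j = 0 := by
  have hN : ∀ t : ℝ, exp (t • -A₁) * Q * exp (t • A₂) ∈ SO p := fun t =>
    SO.mul_mem (SO.mul_mem (exp_skew_mem (by simp [hA₁])) hQ) (exp_skew_mem (by simp [hA₂]))
  have hperm : ∀ t : Icc (0 : ℝ) 1, ∃ σ : Equiv.Perm (Fin p), ∀ j,
      d j * Real.exp (t * l₂ j) = d (σ j) * Real.exp (t * l₁ (σ j)) := fun t =>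
    exists_perm_of_mul_diagonal_eq (SO.isUnit_det (hN t)).ne_zero (h t t.2)
  choose σ' hσ' using hperm
  -- There are finitely many permutations, so that one of them works at two different times.
  have : Infinite (Icc (0 : ℝ) 1) := (Icc_infinite zero_lt_one).to_subtype
  obtain ⟨t, t', htt, hσ⟩ := Finite.exists_ne_map_eq_of_infinite σ'
  have htt' : (t : ℝ) ≠ t' := fun e => htt (Subtype.ext e)
  have hboth : ∀ j, d j = d (σ' t j) ∧ l₂ j = l₁ (σ' t j) := fun j =>
    eq_and_eq_of_mul_exp_eq (hd _) (hd _) htt' (hσ' t j) (by rw [hσ]; exact hσ' t' j)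
  refine ⟨σ' t, fun j => (hboth j).1, fun j => (hboth j).2, fun i j hij => ?_⟩
  set f : ℝ → ℝ := fun u => (exp (u • -A₁) * Q * exp (u • A₂)) i j with hf
  have hzero : ∀ᶠ u in nhdsWithin (0 : ℝ) (Ioi 0), f u = 0 := by
    have hI : ∀ᶠ u in nhdsWithin (0 : ℝ) (Ioi 0), u ∈ Ioo (0 : ℝ) 1 :=
      Ioo_mem_nhdsGT zero_lt_one
    have hne : ∀ᶠ u in nhdsWithin (0 : ℝ) (Ioi 0),
        d i * Real.exp (u * l₁ i) ≠ d j * Real.exp (u * l₂ j) := by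
      by_cases hex : ∃ u₀, d i * Real.exp (u₀ * l₁ i) = d j * Real.exp (u₀ * l₂ j)
      · obtain ⟨u₀, hu₀⟩ := hex
        have hu : ∀ᶠ u in nhdsWithin (0 : ℝ) (Ioi 0), u ≠ u₀ := by
          by_cases h0 : u₀ = 0
          · filter_upwards [self_mem_nhdsWithin] with u hu
            rw [h0]
            exact (mem_Ioi.1 hu).ne'
          · exact eventually_nhdsWithin_of_eventually_nhds (eventually_ne_nhds (Ne.symm h0))
        filter_upwards [hu] with u hu he
        obtain ⟨e1, e2⟩ := eq_and_eq_of_mul_exp_eq (hd i) (hd j) hu he hu₀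
        exact hij (Prod.ext (e1.trans (hboth j).1) (e2.trans (hboth j).2))
      · push Not at hex
        exact Filter.Eventually.of_forall hex
    filter_upwards [hI, hne] with u hu hne
    exact mul_diagonal_eq_iff.1 (h u (Ioo_subset_Icc_self hu)) i j hne
  have hder : HasDerivAt f ((Q * A₂ - A₁ * Q) i j) 0 := by
    have h1 := ((hasDerivAt_exp_smul (-A₁) 0).mul_const Q).mul (hasDerivAt_exp_smul A₂ 0)
    have h2 : HasDerivAt (fun u : ℝ => exp (u • -A₁) * Q * exp (u • A₂)) (Q * A₂ - A₁ * Q) 0 := by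
      refine h1.congr_deriv ?_
      simp only [zero_smul, NormedSpace.exp_zero, one_mul, mul_one, neg_mul]
      abel
    exact hasDerivWithinAt_univ.1 (hasDerivWithinAt_entry h2.hasDerivWithinAt i j)
  have hf0 : f 0 = 0 := by
    have ht : Filter.Tendsto f (nhdsWithin 0 (Ioi 0)) (nhds (f 0)) :=
      hder.continuousAt.tendsto.mono_left nhdsWithin_le_nhds
    exact tendsto_nhds_unique (ht.congr' hzero) tendsto_const_nhds
  constructor
  · simpa [hf] using hf0
  · refine (uniqueDiffWithinAt_Ioi (0 : ℝ)).eq_deriv _ hder.hasDerivWithinAt ?_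
    exact (hasDerivWithinAt_const (0 : ℝ) (Ioi 0) (0 : ℝ)).congr_of_eventuallyEq hzero hf0

/-- The rotational velocities of two MSSR curves with the same image are conjugate. Their
difference after conjugation is block skew-symmetric, and by minimality both velocities are
orthogonal to all such matrices. -/
theorem conj_eq_of_block (hQ : Q ∈ SO p) (hA₁ : A₁ᵀ = -A₁) (hA₂ : A₂ᵀ = -A₂) {e : Fin p → ℝ}
    {σ : Equiv.Perm (Fin p)}
    (h : ∀ i j, e i ≠ e (σ j) → Q i j = 0 ∧ (Q * A₂ - A₁ * Q) i j = 0)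
    (h₁ : ∀ B : Mat p, Bᵀ = -B → Commute B (Matrix.diagonal e) → (A₁ * B).trace = 0)
    (h₂ : ∀ B : Mat p, Bᵀ = -B → Commute B (Matrix.diagonal fun j => e (σ j)) →
      (A₂ * B).trace = 0) :
    A₂ = Qᵀ * A₁ * Q := by
  have hQ1 := SO.transpose_mul hQ
  have hQ2 := SO.mul_transpose hQ
  set G := Q * A₂ - A₁ * Q with hG
  have hE : Qᵀ * G = A₂ - Qᵀ * A₁ * Q := by
    rw [hG, mul_sub, ← mul_assoc, hQ1, one_mul, mul_assoc]
  have hE' : G * Qᵀ = Q * (Qᵀ * G) * Qᵀ := by rw [← mul_assoc Q, hQ2, one_mul]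
  have hskew : (Qᵀ * G)ᵀ = -(Qᵀ * G) := by
    rw [hE]
    simp only [Matrix.transpose_sub, Matrix.transpose_mul, Matrix.transpose_transpose, hA₁, hA₂]
    noncomm_ring
  have hskew' : (G * Qᵀ)ᵀ = -(G * Qᵀ) := by
    rw [hE', Matrix.transpose_mul, Matrix.transpose_mul, hskew, Matrix.transpose_transpose]
    noncomm_ring
  have t2 : (A₂ * (Qᵀ * G)).trace = 0 := by
    refine h₂ _ hskew (mul_diagonal_eq_iff.2 fun i j hij => ?_)
    rw [Matrix.mul_apply]
    refine Finset.sum_eq_zero fun m _ => ?_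
    rw [Matrix.transpose_apply]
    by_cases hm : e m = e (σ i)
    · rw [(h m j (hm ▸ hij)).2, mul_zero]
    · rw [(h m i hm).1, zero_mul]
  have t1 : (A₁ * (G * Qᵀ)).trace = 0 := by
    refine h₁ _ hskew' (mul_diagonal_eq_iff.2 fun i j hij => ?_)
    rw [Matrix.mul_apply]
    refine Finset.sum_eq_zero fun m _ => ?_
    rw [Matrix.transpose_apply]
    by_cases hm : e i = e (σ m)
    · rw [(h j m (hm ▸ hij.symm)).1, mul_zero]
    · rw [(h i m hm).2, zero_mul]
  have t3 : (Qᵀ * A₁ * Q * (Qᵀ * G)).trace = 0 := by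
    have : Qᵀ * A₁ * Q * (Qᵀ * G) = Qᵀ * (A₁ * (Q * Qᵀ) * G) := by noncomm_ring
    rw [this, hQ2, mul_one, Matrix.trace_mul_comm, mul_assoc, t1]
  have hzero : Qᵀ * G = 0 := by
    refine trace_transpose_mul_self_eq_zero ?_
    rw [hskew, neg_mul, Matrix.trace_neg]
    nth_rewrite 1 [hE]
    rw [sub_mul, Matrix.trace_sub, t2, t3, sub_zero, neg_zero]
  exact sub_eq_zero.1 (hE ▸ hzero)

/-- An orthogonal matrix supported on the pairs `(i, j)` for which `i` and `σ j` lie in the same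
block differs from a signed permutation matrix by an element of an identity component. -/
theorem exists_evenSignedPerm_of_block (hQ : Q ∈ SO p) {e : Fin p → ℝ} {σ : Equiv.Perm (Fin p)}
    (h : ∀ i j, (d i, e i) ≠ (d (σ j), e (σ j)) → Q i j = 0) :
    ∃ g : EvenSignedPerm p, g.perm = σ.symm ∧
      ∃ R ∈ stabZero₂ (Matrix.diagonal d) (Matrix.diagonal e), Q = R * g.mat⁻¹ := by
  have hN : Q * permMat σ.symm ∈ blockOrthogonal fun i => (d i, e i) := by
    refine ⟨?_, fun i j hij => ?_⟩
    · rw [Matrix.transpose_mul, mul_assoc, ← mul_assoc (permMat _), permMat_mul_transpose, one_mul,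
        SO.mul_transpose hQ]
    · rw [mul_permMat_apply]
      exact h _ _ (by simpa using hij)
  obtain ⟨s, hs⟩ := exists_mul_signMat_mem_component hN
  have hR := (connectedComponentIn_subset _ _ hs).1
  have hdet := (mem_SO_iff.1 hR).2
  rw [mul_assoc, Matrix.det_mul, (mem_SO_iff.1 hQ).2, one_mul] at hdet
  obtain ⟨g, hg, hgm⟩ := exists_evenSignedPerm σ.symm s hdet
  refine ⟨g, hg, Q * permMat σ.symm * signMat s, ?_, ?_⟩
  · rw [stabZero₂, stab_inter_stab_diagonal]
    exact hs
  · rw [mul_assoc Q, ← hgm, mul_assoc, g.mul_inv, mul_one]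

end Necessity

end ScalingRotation

/-! ### Comparison of two curves -/

namespace ScalingRotation

variable {p : ℕ} {k : ℝ}

section Comparison

variable {X Y : Mat p}

/-- The parameters of an MSSR curve: its geodesic is `t ↦ (W exp (t A), diag (d e^{t l}))`. The
last three clauses record minimality: orthogonality to the fiber, the value of the length, and
minimality of the rotation part in `SO(p)`. -/
theorem IsMSSRCurve.exists_parameters (hk : 0 < k) {W Z Λ : Mat p} {d : Fin p → ℝ}
    {γ : ℝ → Mat p × Mat p} {χ : ℝ → Mat p}
    (h : IsMSSRCurve k X Y (W, Matrix.diagonal d) (Z, Λ) γ χ) :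
    ∃ (A : Mat p) (l : Fin p → ℝ), Aᵀ = -A ∧ Z = W * exp A ∧
      Λ = Matrix.diagonal (fun j => d j * Real.exp (l j)) ∧
      (∀ t ∈ Icc (0 : ℝ) 1, χ t = W * exp (t • A) *
        Matrix.diagonal (fun j => d j * Real.exp (t * l j)) * (W * exp (t • A))ᵀ) ∧
      (derivWithin γ (Icc 0 1) 0).1 = W * A ∧
      (∀ B : Mat p, Bᵀ = -B → Commute B Λ → (A * B).trace = 0) ∧
      k * (-(1 / 2) * (A * A).trace) + ∑ j, l j ^ 2 = dSR k X Y ^ 2 ∧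
      Real.sqrt (-(1 / 2) * (A * A).trace) ≤ geodesicDist (SO p) gSO W Z := by
  obtain ⟨⟨A, L⟩, ⟨hA, l, hL⟩, hγ, hvel, hlen, horth⟩ := h.exists_eq_expCurve hk
  simp only at hA hL hvel horth
  subst hL
  have h0 : (0 : ℝ) ∈ Icc (0 : ℝ) 1 := left_mem_Icc.2 zero_le_one
  have h1 : (1 : ℝ) ∈ Icc (0 : ℝ) 1 := right_mem_Icc.2 zero_le_one
  have hend := h.target_eq.symm.trans (hγ 1 h1)
  have hq : (W, Matrix.diagonal d) ∈ M p := h.source_eq ▸ h.isFMinimal.source.1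
  have ha : ((A, Matrix.diagonal l) : Mat p × Mat p) ∈ lieAlg p := ⟨hA, l, rfl⟩
  have hZ : Z = W * exp A := by simpa [expCurve] using congrArg Prod.fst hend
  have hΛ := congrArg Prod.snd hend
  simp only [expCurve, diagonal_mul_exp, one_mul] at hΛ
  refine ⟨A, l, hA, hZ, hΛ, fun t ht => ?_, hvel, horth, ?_, ?_⟩
  · rw [h.eq_comp t ht, hγ t ht]
    simp only [F, expCurve, diagonal_mul_exp]
  · rw [← h.isFMinimal.minimal, hlen, Real.sq_sqrt (lieForm_self_nonneg hk.le ha)]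
    have e : (Matrix.diagonal l * Matrix.diagonal l).trace = ∑ j, l j ^ 2 := by
      rw [Matrix.diagonal_mul_diagonal, Matrix.trace_diagonal]
      exact Finset.sum_congr rfl fun j _ => (sq (l j)).symm
    simp only [lieForm, e]
    ring
  · have hpath : IsPiecewiseSmoothIn (SO p) fun t : ℝ => W * exp (t • A) :=
      isPiecewiseSmoothIn_of_contDiffOn (contDiff_mul_exp W A).contDiffOn
        fun t _ => mul_exp_mem hq.1 hA t
    refine le_csInf ⟨_, _, hpath, by simp, by simp [hZ], rfl⟩ ?_
    rintro _ ⟨η, hη, e0, e1, rfl⟩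
    refine sqrt_le_curveLength_gSO hk hq ha (fun ζ hζ z0 z1 => ?_) hη e0 (e1.trans hZ)
    rw [← hlen, h.isFMinimal.minimal]
    refine dSR_le_curveLength hζ (z0 ▸ h.source_eq ▸ h.isFMinimal.source) ?_
    rw [z1, ← hγ 1 h1]
    exact h.isFMinimal.target

theorem conj_diagonal_eq_iff {P₁ P₂ Δ₁ Δ₂ : Mat p} (h₁ : P₁ ∈ SO p) (h₂ : P₂ ∈ SO p) :
    P₁ * Δ₁ * P₁ᵀ = P₂ * Δ₂ * P₂ᵀ ↔ P₁ᵀ * P₂ * Δ₂ = Δ₁ * (P₁ᵀ * P₂) := by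
  constructor
  · intro h
    calc P₁ᵀ * P₂ * Δ₂ = P₁ᵀ * P₂ * Δ₂ * (P₂ᵀ * P₂) := by rw [SO.transpose_mul h₂, mul_one]
      _ = P₁ᵀ * (P₂ * Δ₂ * P₂ᵀ) * P₂ := by noncomm_ring
      _ = P₁ᵀ * P₁ * Δ₁ * (P₁ᵀ * P₂) := by rw [← h]; noncomm_ring
      _ = Δ₁ * (P₁ᵀ * P₂) := by rw [SO.transpose_mul h₁, one_mul]
  · intro h
    calc P₁ * Δ₁ * P₁ᵀ = P₁ * Δ₁ * P₁ᵀ * (P₂ * P₂ᵀ) := by rw [SO.mul_transpose h₂, mul_one]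
      _ = P₁ * (Δ₁ * (P₁ᵀ * P₂)) * P₂ᵀ := by noncomm_ring
      _ = P₁ * P₁ᵀ * P₂ * Δ₂ * P₂ᵀ := by rw [← h]; noncomm_ring
      _ = P₂ * Δ₂ * P₂ᵀ := by rw [SO.mul_transpose h₁, one_mul]

theorem transpose_mul_exp_mul {W Q A₁ A₂ : Mat p} (hW : W ∈ SO p) (hA₁ : A₁ᵀ = -A₁) (t : ℝ) :
    (W * exp (t • A₁))ᵀ * (W * Q * exp (t • A₂)) = exp (t • -A₁) * Q * exp (t • A₂) := by
  rw [Matrix.transpose_mul, ← Matrix.exp_transpose, Matrix.transpose_smul, hA₁]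
  calc exp (t • -A₁) * Wᵀ * (W * Q * exp (t • A₂))
      = exp (t • -A₁) * (Wᵀ * W) * Q * exp (t • A₂) := by noncomm_ring
    _ = exp (t • -A₁) * Q * exp (t • A₂) := by rw [SO.transpose_mul hW, mul_one]

theorem permAct_diagonal (π : Equiv.Perm (Fin p)) (e : Fin p → ℝ) :
    permAct π (Matrix.diagonal e) = Matrix.diagonal fun i => e (π.symm i) := by
  simp [permAct]

variable {W Q A₁ A₂ : Mat p} {d l₁ l₂ : Fin p → ℝ} {χ₁ χ₂ : ℝ → Mat p}

/-- Equal MSSR curves have conjugate rotational velocities and frames that differ by a stabilizing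
element followed by a signed permutation. -/
theorem velocity_conj_and_exists_of_eqOn (hW : W ∈ SO p) (hQ : Q ∈ SO p) (hd : ∀ i, 0 < d i)
    (hA₁ : A₁ᵀ = -A₁) (hA₂ : A₂ᵀ = -A₂)
    (hχ₁ : ∀ t ∈ Icc (0 : ℝ) 1, χ₁ t = W * exp (t • A₁) *
        Matrix.diagonal (fun j => d j * Real.exp (t * l₁ j)) * (W * exp (t • A₁))ᵀ)
    (hχ₂ : ∀ t ∈ Icc (0 : ℝ) 1, χ₂ t = W * Q * exp (t • A₂) *
        Matrix.diagonal (fun j => d j * Real.exp (t * l₂ j)) * (W * Q * exp (t • A₂))ᵀ)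
    (ho₁ : ∀ B : Mat p, Bᵀ = -B →
      Commute B (Matrix.diagonal fun j => d j * Real.exp (l₁ j)) → (A₁ * B).trace = 0)
    (ho₂ : ∀ B : Mat p, Bᵀ = -B →
      Commute B (Matrix.diagonal fun j => d j * Real.exp (l₂ j)) → (A₂ * B).trace = 0)
    (h : EqOn χ₁ χ₂ (Icc 0 1)) :
    A₂ = Qᵀ * A₁ * Q ∧ ∃ g : EvenSignedPerm p,
      ∃ R ∈ stabZero₂ (Matrix.diagonal d) (Matrix.diagonal fun j => d j * Real.exp (l₁ j)),
        Matrix.diagonal d = permAct g.perm (Matrix.diagonal d) ∧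
        (Matrix.diagonal fun j => d j * Real.exp (l₂ j)) =
          permAct g.perm (Matrix.diagonal fun j => d j * Real.exp (l₁ j)) ∧
        Q = R * g.mat⁻¹ := by
  obtain ⟨σ, hσd, hσl, hblock⟩ := exists_perm_of_conj_family (l₁ := l₁) (l₂ := l₂) hd hQ hA₁ hA₂
    fun t ht => by
      have e := h ht
      rw [hχ₁ t ht, hχ₂ t ht, conj_diagonal_eq_iff (mul_exp_mem hW hA₁ t)
        (mul_exp_mem (SO.mul_mem hW hQ) hA₂ t), transpose_mul_exp_mul hW hA₁] at e
      exact e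
  have he : ∀ j, d j * Real.exp (l₂ j) = d (σ j) * Real.exp (l₁ (σ j)) := fun j => by
    rw [hσl, ← hσd]
  refine ⟨conj_eq_of_block hQ hA₁ hA₂ (e := fun j => d j * Real.exp (l₁ j)) (σ := σ)
    (fun i j hij => hblock i j fun e => hij ?_) ho₁ (by simpa only [he] using ho₂), ?_⟩
  · rw [Prod.ext_iff] at e
    simp only at e
    rw [e.1, e.2]
  · obtain ⟨g, hg, R, hR, hQR⟩ := exists_evenSignedPerm_of_block (d := d)
      (e := fun j => d j * Real.exp (l₁ j)) (σ := σ) hQ fun i j hij => (hblock i j fun e => hij (by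
        rw [Prod.ext_iff] at e ⊢
        simp only at e ⊢
        exact ⟨e.1, by rw [e.1, e.2]⟩)).1
    refine ⟨g, R, hR, ?_, ?_, hQR⟩
    · rw [permAct_diagonal, hg, Equiv.symm_symm, ← funext hσd]
    · rw [permAct_diagonal, hg, Equiv.symm_symm]
      exact congrArg _ (funext he)

theorem exponent_eq_of_diagonal_eq (hd : ∀ i, 0 < d i) {i j : Fin p} (h : d i = d j)
    (h' : d i * Real.exp (l₁ i) = d j * Real.exp (l₂ j)) : l₁ i = l₂ j := by
  rw [h] at h'
  exact Real.exp_injective (mul_left_cancel₀ (hd j).ne' h')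

theorem exponent_eq_of_permAct_eq (hd : ∀ i, 0 < d i) {π : Equiv.Perm (Fin p)}
    (hD : Matrix.diagonal d = permAct π (Matrix.diagonal d))
    (hΛ : (Matrix.diagonal fun j => d j * Real.exp (l₂ j)) =
      permAct π (Matrix.diagonal fun j => d j * Real.exp (l₁ j))) (i : Fin p) :
    d i = d (π.symm i) ∧ l₂ i = l₁ (π.symm i) := by
  rw [permAct_diagonal] at hD hΛ
  have h1 := congrFun (Matrix.diagonal_injective hD) i
  have h2 := congrFun (Matrix.diagonal_injective hΛ) i
  exact ⟨h1, exponent_eq_of_diagonal_eq hd h1 h2⟩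

theorem eqOn_of_velocity_conj (hW : W ∈ SO p) (hQ : Q ∈ SO p) (hd : ∀ i, 0 < d i)
    (hA₁ : A₁ᵀ = -A₁) (hA₂ : A₂ᵀ = -A₂)
    (hχ₁ : ∀ t ∈ Icc (0 : ℝ) 1, χ₁ t = W * exp (t • A₁) *
        Matrix.diagonal (fun j => d j * Real.exp (t * l₁ j)) * (W * exp (t • A₁))ᵀ)
    (hχ₂ : ∀ t ∈ Icc (0 : ℝ) 1, χ₂ t = W * Q * exp (t • A₂) *
        Matrix.diagonal (fun j => d j * Real.exp (t * l₂ j)) * (W * Q * exp (t • A₂))ᵀ)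
    {g : EvenSignedPerm p} {R : Mat p}
    (hR : R ∈ stabZero₂ (Matrix.diagonal d) (Matrix.diagonal fun j => d j * Real.exp (l₁ j)))
    (hl : ∀ i, d i = d (g.perm.symm i) ∧ l₂ i = l₁ (g.perm.symm i)) (hQR : Q = R * g.mat⁻¹)
    (hconj : A₂ = Qᵀ * A₁ * Q) : EqOn χ₁ χ₂ (Icc 0 1) := by
  intro t ht
  rw [hχ₁ t ht, hχ₂ t ht, conj_diagonal_eq_iff (mul_exp_mem hW hA₁ t)
    (mul_exp_mem (SO.mul_mem hW hQ) hA₂ t), transpose_mul_exp_mul hW hA₁]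
  have hexp : exp (t • -A₁) * Q * exp (t • A₂) = Q := by
    have e : t • A₂ = Q⁻¹ * (t • A₁) * Q := by
      rw [SO.inv_eq hQ, hconj, mul_smul_comm, smul_mul_assoc]
    have e1 : Q * Q⁻¹ = 1 := Matrix.mul_nonsing_inv _ (SO.isUnit_det hQ)
    rw [e, Matrix.exp_conj' _ _ (SO.isUnit hQ), smul_neg, Matrix.exp_neg]
    calc (exp (t • A₁))⁻¹ * Q * (Q⁻¹ * exp (t • A₁) * Q)
        = (exp (t • A₁))⁻¹ * (Q * Q⁻¹) * exp (t • A₁) * Q := by noncomm_ring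
      _ = Q := by rw [e1, mul_one, exp_inv_mul, one_mul]
  rw [hexp, hQR]
  set Δ₁ := Matrix.diagonal fun j => d j * Real.exp (t * l₁ j) with hΔ₁
  set Δ₂ := Matrix.diagonal fun j => d j * Real.exp (t * l₂ j) with hΔ₂
  have h1 : g.mat * Δ₁ = Δ₂ * g.mat := g.mat_mul_diagonal fun i => by rw [← (hl i).1, (hl i).2]
  have h2 : R * Δ₁ = Δ₁ * R := by
    have hRs := connectedComponentIn_subset _ _ hR
    rw [stab_inter_stab_diagonal] at hRs
    refine mul_diagonal_eq_iff.2 fun i j hne => hRs.2.2 i j fun e => hne ?_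
    rw [Prod.ext_iff] at e
    simp only at e
    rw [e.1, exponent_eq_of_diagonal_eq hd e.1 e.2]
  have h3 := g.mul_inv
  have h4 : g.mat⁻¹ * g.mat = 1 := mul_eq_one_comm.1 h3
  calc R * g.mat⁻¹ * Δ₂ = R * g.mat⁻¹ * (Δ₂ * g.mat) * g.mat⁻¹ := by
        rw [mul_assoc _ _ g.mat⁻¹, mul_assoc Δ₂, h3, mul_one]
    _ = R * (g.mat⁻¹ * g.mat) * Δ₁ * g.mat⁻¹ := by rw [← h1]; noncomm_ring
    _ = Δ₁ * (R * g.mat⁻¹) := by rw [h4, mul_one, h2, mul_assoc]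

/-- Equality of two conjugates, in the form of the velocity and the endpoint conditions. -/
theorem frame_conj_eq_iff {U R₁ R₂ B₁ B₂ : Mat p} (hU : U ∈ SO p) (h₁ : R₁ ∈ SO p)
    (h₂ : R₂ ∈ SO p) :
    U * R₁ * B₁ * R₁⁻¹ = U * R₂ * B₂ * R₂⁻¹ ↔
      B₂ = (R₁⁻¹ * R₂)ᵀ * B₁ * (R₁⁻¹ * R₂) := by
  rw [SO.inv_eq h₁, SO.inv_eq h₂, Matrix.transpose_mul, Matrix.transpose_transpose]
  constructor
  · intro h
    calc B₂ = R₂ᵀ * R₂ * B₂ * (R₂ᵀ * R₂) := by rw [SO.transpose_mul h₂, one_mul, mul_one]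
      _ = R₂ᵀ * (Uᵀ * U) * R₂ * B₂ * R₂ᵀ * R₂ := by
          rw [SO.transpose_mul hU, mul_one]
          noncomm_ring
      _ = R₂ᵀ * Uᵀ * (U * R₂ * B₂ * R₂ᵀ) * R₂ := by noncomm_ring
      _ = R₂ᵀ * (Uᵀ * U) * R₁ * B₁ * R₁ᵀ * R₂ := by rw [← h]; noncomm_ring
      _ = R₂ᵀ * R₁ * B₁ * (R₁ᵀ * R₂) := by
          rw [SO.transpose_mul hU, mul_one]
          noncomm_ring
  · intro h
    calc U * R₁ * B₁ * R₁ᵀ = U * (R₂ * R₂ᵀ) * R₁ * B₁ * R₁ᵀ * (R₂ * R₂ᵀ) := by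
          rw [SO.mul_transpose h₂, mul_one, mul_one]
      _ = U * R₂ * (R₂ᵀ * R₁ * B₁ * (R₁ᵀ * R₂)) * R₂ᵀ := by noncomm_ring
      _ = U * R₂ * B₂ * R₂ᵀ := by rw [← h]

end Comparison

section Main

theorem mssr_eqOn_iff (hk : 0 < k) {X Y U D V Λ : Mat p} (hUD : (U, D) ∈ fiber X)
    (hVΛ : (V, Λ) ∈ fiber Y) {RU₁ RU₂ RV₁ RV₂ : Mat p} (hRU₁ : RU₁ ∈ stabZero D)
    (hRU₂ : RU₂ ∈ stabZero D) {g₁ g₂ : EvenSignedPerm p} {Λ₁ Λ₂ : Mat p}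
    {γ₁ γ₂ : ℝ → Mat p × Mat p} {χ₁ χ₂ : ℝ → Mat p}
    (h₁ : IsMSSRCurve k X Y (U * RU₁, D) (V * RV₁ * g₁.mat⁻¹, Λ₁) γ₁ χ₁)
    (h₂ : IsMSSRCurve k X Y (U * RU₂, D) (V * RV₂ * g₂.mat⁻¹, Λ₂) γ₂ χ₂) :
    (EqOn χ₁ χ₂ (Icc 0 1) ↔
      (((¬ GeodesicallyAntipodal (U * RU₁) (V * RV₁ * g₁.mat⁻¹) ∧
          ¬ GeodesicallyAntipodal (U * RU₂) (V * RV₂ * g₂.mat⁻¹) ∧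
          RV₂ * g₂.mat⁻¹ * RU₂⁻¹ = RV₁ * g₁.mat⁻¹ * RU₁⁻¹) ∨
        (GeodesicallyAntipodal (U * RU₁) (V * RV₁ * g₁.mat⁻¹) ∧
          GeodesicallyAntipodal (U * RU₂) (V * RV₂ * g₂.mat⁻¹) ∧
          (derivWithin γ₁ (Icc 0 1) 0).1 * RU₁⁻¹ = (derivWithin γ₂ (Icc 0 1) 0).1 * RU₂⁻¹)) ∧
      (∃ g : EvenSignedPerm p, ∃ R ∈ stabZero₂ D Λ₁,
        D = permAct g.perm D ∧ Λ₂ = permAct g.perm Λ₁ ∧ RU₁⁻¹ * RU₂ = R * g.mat⁻¹))) ∧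
    ((derivWithin γ₁ (Icc 0 1) 0).1 * RU₁⁻¹ = (derivWithin γ₂ (Icc 0 1) 0).1 * RU₂⁻¹ →
      RV₂ * g₂.mat⁻¹ * RU₂⁻¹ = RV₁ * g₁.mat⁻¹ * RU₁⁻¹) ∧
    (EqOn χ₁ χ₂ (Icc 0 1) →
      RV₂ * g₂.mat⁻¹ * RU₂⁻¹ = RV₁ * g₁.mat⁻¹ * RU₁⁻¹) := by
  have hU : U ∈ SO p := hUD.1.1
  have hV : V ∈ SO p := hVΛ.1.1
  obtain ⟨d, hd, rfl⟩ := hUD.1.2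
  have hR₁ : RU₁ ∈ SO p := (connectedComponentIn_subset _ _ hRU₁).1
  have hR₂ : RU₂ ∈ SO p := (connectedComponentIn_subset _ _ hRU₂).1
  obtain ⟨A₁, l₁, hA₁, hZ₁, rfl, hχ₁, hv₁, ho₁, hlen₁, hmin₁⟩ := h₁.exists_parameters hk
  obtain ⟨A₂, l₂, hA₂, hZ₂, rfl, hχ₂, hv₂, ho₂, hlen₂, hmin₂⟩ := h₂.exists_parameters hk
  have hb := frame_conj_eq_iff (B₁ := A₁) (B₂ := A₂) hU hR₁ hR₂
  have ha := frame_conj_eq_iff (B₁ := exp A₁) (B₂ := exp A₂) hU hR₁ hR₂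
  set Q := RU₁⁻¹ * RU₂ with hQdef
  have hQ : Q ∈ SO p := SO.mul_mem (SO.inv_mem hR₁) hR₂
  set W := U * RU₁ with hWdef
  have hW : W ∈ SO p := SO.mul_mem hU hR₁
  have hWQ : U * RU₂ = W * Q := by
    have e : RU₁ * RU₁⁻¹ = 1 := Matrix.mul_nonsing_inv _ (SO.isUnit_det hR₁)
    rw [hWdef, hQdef, mul_assoc, ← mul_assoc RU₁, e, one_mul]
  clear_value Q
  have hexpconj : A₂ = Qᵀ * A₁ * Q → exp A₂ = Qᵀ * exp A₁ * Q := fun h => by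
    rw [h, ← SO.inv_eq hQ, Matrix.exp_conj' _ _ (SO.isUnit hQ)]
  -- The endpoint condition says that the rotations `exp A₁` and `exp A₂` are conjugate.
  have ha' : RV₂ * g₂.mat⁻¹ * RU₂⁻¹ = RV₁ * g₁.mat⁻¹ * RU₁⁻¹ ↔ exp A₂ = Qᵀ * exp A₁ * Q := by
    rw [← ha, ← hZ₁, ← hZ₂]
    have e : ∀ x y z : Mat p, V * x * y * z = V * (x * y * z) := fun x y z => by noncomm_ring
    rw [e, e]
    refine ⟨fun h => by rw [h], fun h => ?_⟩
    have := congrArg (Vᵀ * ·) h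
    simp only [← mul_assoc, SO.transpose_mul hV, one_mul] at this
    simpa only [mul_assoc] using this.symm
  rw [hv₁, hv₂, hb, ha']
  rw [hWQ] at hχ₂ hZ₂ hmin₂ ⊢
  have hnec := velocity_conj_and_exists_of_eqOn hW hQ hd hA₁ hA₂ hχ₁ hχ₂ ho₁ ho₂
  refine ⟨⟨fun h => ?_, ?_⟩, hexpconj, fun h => hexpconj (hnec h).1⟩
  · obtain ⟨hconj, hex⟩ := hnec h
    refine ⟨?_, hex⟩
    -- Right translation by `Q` takes the endpoints of the first rotation to those of the second.
    have hZ : V * RV₂ * g₂.mat⁻¹ = V * RV₁ * g₁.mat⁻¹ * Q := by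
      rw [hZ₂, hZ₁, hexpconj hconj]
      calc W * Q * (Qᵀ * exp A₁ * Q) = W * (Q * Qᵀ) * exp A₁ * Q := by noncomm_ring
        _ = W * exp A₁ * Q := by rw [SO.mul_transpose hQ, mul_one]
    have hiff : GeodesicallyAntipodal (W * Q) (V * RV₂ * g₂.mat⁻¹) ↔
        GeodesicallyAntipodal W (V * RV₁ * g₁.mat⁻¹) := by
      rw [hZ]
      refine ⟨fun h => ?_, fun h => h.mul_right hQ⟩
      have := h.mul_right (SO.transpose_mem hQ)
      rwa [mul_assoc, mul_assoc _ Q, SO.mul_transpose hQ, mul_one, mul_one] at this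
    by_cases hanti : GeodesicallyAntipodal W (V * RV₁ * g₁.mat⁻¹)
    · exact Or.inr ⟨hanti, hiff.2 hanti, hconj⟩
    · exact Or.inl ⟨hanti, fun h => hanti (hiff.1 h), hexpconj hconj⟩
  · rintro ⟨hi, g, R, hR, hD, hΛ, hQR⟩
    have hl := exponent_eq_of_permAct_eq hd hD hΛ
    refine eqOn_of_velocity_conj hW hQ hd hA₁ hA₂ hχ₁ hχ₂ hR hl hQR ?_
    rcases hi with ⟨hanti, -, hE⟩ | ⟨-, -, hE⟩
    · by_contra hne
      refine hanti (Or.inl ?_)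
      set B := Q * A₂ * Qᵀ with hB
      have hBs : Bᵀ = -B := by
        rw [hB, Matrix.transpose_mul, Matrix.transpose_mul, Matrix.transpose_transpose, hA₂]
        noncomm_ring
      have hBA : Qᵀ * B * Q = A₂ := by
        calc Qᵀ * B * Q = Qᵀ * Q * A₂ * (Qᵀ * Q) := by rw [hB]; noncomm_ring
          _ = A₂ := by rw [SO.transpose_mul hQ, one_mul, mul_one]
      have hexpB : exp A₁ = exp B := by
        rw [hB, ← SO.inv_eq hQ, Matrix.exp_conj _ _ (SO.isUnit hQ), hE, SO.inv_eq hQ]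
        calc exp A₁ = Q * Qᵀ * exp A₁ * (Q * Qᵀ) := by
              rw [SO.mul_transpose hQ, one_mul, mul_one]
          _ = Q * (Qᵀ * exp A₁ * Q) * Qᵀ := by noncomm_ring
      -- The diagonal parts have equal speeds, hence so do the rotation parts.
      have hsum : ∑ j, l₂ j ^ 2 = ∑ j, l₁ j ^ 2 := by
        rw [← Equiv.sum_comp g.perm.symm fun j => l₁ j ^ 2]
        exact Finset.sum_congr rfl fun j _ => by rw [(hl j).2]
      have htrB : (B * B).trace = (A₂ * A₂).trace := by
        have : B * B = Q * (A₂ * (Qᵀ * Q) * A₂ * Qᵀ) := by rw [hB]; noncomm_ring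
        rw [this, Matrix.trace_mul_comm, SO.transpose_mul hQ, mul_one, mul_assoc,
          SO.transpose_mul hQ, mul_one]
      have htr : (A₁ * A₁).trace = (B * B).trace := by
        rw [htrB]
        have e : k * (-(1 / 2) * (A₁ * A₁).trace) = k * (-(1 / 2) * (A₂ * A₂).trace) := by
          linarith
        have := mul_left_cancel₀ hk.ne' e
        linarith
      rw [hZ₁] at hmin₁ ⊢
      exact mul_exp_mem_cutLocus hW hA₁ hBs hexpB
        (fun h => hne (by rw [h, hBA])) htr hmin₁
    · exact hE

end Main

end ScalingRotation

end

theorem mainTheorem11 (p : ℕ) (k : ℝ) (hk : 0 < k)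
    (X Y : Mat p) (hX : X.PosDef) (hY : Y.PosDef) (hXY : X ≠ Y)
    (U D V Λ : Mat p) (hUD : (U, D) ∈ fiber X) (hVΛ : (V, Λ) ∈ fiber Y)
    (RU₁ RU₂ RV₁ RV₂ : Mat p)
    (hRU₁ : RU₁ ∈ stabZero D) (hRU₂ : RU₂ ∈ stabZero D)
    (hRV₁ : RV₁ ∈ stabZero Λ) (hRV₂ : RV₂ ∈ stabZero Λ)
    (g₁ g₂ : EvenSignedPerm p)
    (Λ₁ Λ₂ : Mat p) (hΛ₁ : Λ₁ = permAct g₁.perm Λ) (hΛ₂ : Λ₂ = permAct g₂.perm Λ)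
    (γ₁ γ₂ : ℝ → Mat p × Mat p) (χ₁ χ₂ : ℝ → Mat p)
    (h₁ : IsMSSRCurve k X Y (U * RU₁, D) (V * RV₁ * g₁.mat⁻¹, Λ₁) γ₁ χ₁)
    (h₂ : IsMSSRCurve k X Y (U * RU₂, D) (V * RV₂ * g₂.mat⁻¹, Λ₂) γ₂ χ₂) :
    (EqOn χ₁ χ₂ (Icc 0 1) ↔
      (((¬ GeodesicallyAntipodal (U * RU₁) (V * RV₁ * g₁.mat⁻¹) ∧
          ¬ GeodesicallyAntipodal (U * RU₂) (V * RV₂ * g₂.mat⁻¹) ∧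
          RV₂ * g₂.mat⁻¹ * RU₂⁻¹ = RV₁ * g₁.mat⁻¹ * RU₁⁻¹) ∨
        (GeodesicallyAntipodal (U * RU₁) (V * RV₁ * g₁.mat⁻¹) ∧
          GeodesicallyAntipodal (U * RU₂) (V * RV₂ * g₂.mat⁻¹) ∧
          (derivWithin γ₁ (Icc 0 1) 0).1 * RU₁⁻¹ = (derivWithin γ₂ (Icc 0 1) 0).1 * RU₂⁻¹)) ∧
      (∃ g : EvenSignedPerm p, ∃ R ∈ stabZero₂ D Λ₁,
        D = permAct g.perm D ∧ Λ₂ = permAct g.perm Λ₁ ∧ RU₁⁻¹ * RU₂ = R * g.mat⁻¹))) ∧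
    ((derivWithin γ₁ (Icc 0 1) 0).1 * RU₁⁻¹ = (derivWithin γ₂ (Icc 0 1) 0).1 * RU₂⁻¹ →
      RV₂ * g₂.mat⁻¹ * RU₂⁻¹ = RV₁ * g₁.mat⁻¹ * RU₁⁻¹) ∧
    (EqOn χ₁ χ₂ (Icc 0 1) →
      RV₂ * g₂.mat⁻¹ * RU₂⁻¹ = RV₁ * g₁.mat⁻¹ * RU₁⁻¹) :=
  mssr_eqOn_iff hk hUD hVΛ hRU₁ hRU₂ h₁ h₂
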